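/- Let $(X,h_X)$ be an isotropic $L$-space, that is: $X$ is a set with a commutative associative addition with neutral element $\theta$ and a multiplication by real numbers such that $\alpha(x+y)=\alpha x+\alpha y$, $\alpha(\beta x)=(\alpha\beta)x$, $1x=x$, $0x=\theta$, and $h_X$ is a complete separable metric on $X$ with $h_X(\alpha x,\alpha y)=|\alpha|h_X(x,y)$ and $h_X(x+z,y+z)=h_X(x,y)$. Put $\|x\|_X=h_X(x,\theta)$. Let $X^{\rm c}$ be the set of convex elements ($(\alpha+\beta)x=\alpha x+\beta x$ for all $\alpha,\beta\ge0$) and $X^{\rm inv}$ the set of $x$ for which some $x'$ has $x+x'=\theta$; assume $X^{\rm inv}\cap X^{\rm c}\ne\{\theta\}$. Let $P\colon X\to X^{\rm c}$ be a convexifying operator, i.e. surjective, with $h_X(P(x),P(y))\le h_X(x,y)$, $P\circ P=P$ and $P(\alpha x+\beta y)=\alpha P(x)+\beta P(y)$ for all $\alpha,\beta\in\mathbb R$. The integral of a simple function with values $f_k$ on disjoint measurable sets $T_k$ is $\sum_k \mu(T_k)P(f_k)$, where $\mu$ is Lebesgue measure, and the integral of a uniform limit of simple functions is the limit of their integrals.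 The Hukuhara difference $x-_Hy$ is the element $z$ with $x=y+z$, if it exists (it is then unique). The Hukuhara type derivative $\mathcal D_Hf(t)$ is the common value of $\lim_{\gamma\to+0}\gamma^{-1}(f(t+\gamma)-_Hf(t))$ and $\lim_{\gamma\to+0}\gamma^{-1}(f(t)-_Hf(t-\gamma))$, where the differences are required to exist for all small $\gamma>0$; at an end point of the interval only the limit that makes sense there is used. Let $\omega\colon[0,\infty)\to[0,\infty)$ be a modulus of continuity (continuous, non-decreasing, $\omega(s+t)\le\omega(s)+\omega(t)$, $\omega(0)=0$), and let $a<b$. Let $W^1H^\omega=W^1H^\omega([a,b],X)$ be the class of functions $f(u)=x+\int_a^u\phi(s)\,ds$, $u\in[a,b]$, with $x\in X^{\rm c}$ and $\phi\colon[a,b]\to X$ such that $h_X(\phi(s),\phi(s'))\le\omega(|s-s'|)$ for all $s,s'\in[a,b]$. Let $C^H=C^H([a,b],X)$ be the cone of continuous $f\colon[a,b]\to X$ for which $f(v)-_Hf(u)$ exists whenever $a\le u<v\le b$. For a positively homogeneous $T\colon C^H\to X$ let $\|T\|$ be the supremum of $\|Tf\|_X$ over $f\in C^H$ with $\sup_{u\in[a,b]}\|f(u)\|_X\le1$.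 For an operator $A\colon W^1H^\omega\to X$ and $N>0$ set $$U(A,T)=\sup_{f\in W^1H^\omega}h_X(Af,Tf),\qquad E(A,N)=\inf_{\|T\|\le N}U(A,T),$$ the infimum being over the positively homogeneous operators $T\colon C^H\to X$ with $\|T\|\le N$. Let $t\in[a,b]$, $h>\gamma>0$, and put $\gamma_1=\min\{\gamma,t-a\}$, $\gamma_2=\min\{\gamma,b-t\}$, $h_1=\min\{h,t-a\}$, $h_2=\min\{h,b-t\}$. Let $$\Delta_{\gamma_1,\gamma_2}(t)f=\frac{f(t+\gamma_2)-_Hf(t-\gamma_1)}{\gamma_1+\gamma_2},\quad \Delta_{h_1,h_2}(t)f=\frac{f(t+h_2)-_Hf(t-h_1)}{h_1+h_2},\quad \mathcal D_H(t)f=\mathcal D_Hf(t),$$ let $I(\alpha)=\int_0^\alpha\omega(s)\,ds$, and $$K(\gamma_1,\gamma_2;h_1,h_2)=\frac{(h_1-\gamma_1)+(h_2-\gamma_2)}{(h_1+h_2)^2}\left\{I\left(\frac{(h_1+h_2)(h_1-\gamma_1)}{(h_1-\gamma_1)+(h_2-\gamma_2)}\right)+I\left(\frac{(h_1+h_2)(h_2-\gamma_2)}{(h_1-\gamma_1)+(h_2-\gamma_2)}\right)\right\},$$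 with $K=0$ if $\gamma_1=h_1$ and $\gamma_2=h_2$. Then $W^1H^\omega\subset C^H$, every $f\in W^1H^\omega$ has a Hukuhara type derivative at $t$, and $\Delta_{h_1,h_2}(t)$ is a positively homogeneous operator on $C^H$ with $\|\Delta_{h_1,h_2}(t)\|\le\frac2{h_1+h_2}$. If $\omega$ is concave, then $$E\left(\Delta_{\gamma_1,\gamma_2}(t),\tfrac2{h_1+h_2}\right)=U\left(\Delta_{\gamma_1,\gamma_2}(t),\Delta_{h_1,h_2}(t)\right)=K(\gamma_1,\gamma_2;h_1,h_2),$$ and for an arbitrary modulus of continuity $\omega$ $$E\left(\mathcal D_H(t),\tfrac2{h_1+h_2}\right)=U\left(\mathcal D_H(t),\Delta_{h_1,h_2}(t)\right)=\frac{I(h_1)+I(h_2)}{h_1+h_2}.$$ In particular, in both cases the infimum is attained by $\Delta_{h_1,h_2}(t)$. -/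

import Mathlib

open Set Filter Topology MeasureTheory
open scoped ENNReal

namespace LSpaces

noncomputable section

/-- An `L`-space: a semilinear space (the laws `x + y = y + x`, `x + (y + z) = (x + y) + z`,
`x + 0 = x`, `α • (x + y) = α • x + α • y`, `α • β • x = (α * β) • x`, `1 • x = x` come from
`AddCommMonoid` and `DistribMulAction`; `0 • x = 0` is added here; no law for `(α + β) • x`) with
a complete separable metric that satisfies `h (α x) (α y) = |α| h x y` and
`h (x + z) (y + z) ≤ h x y`. -/
class LSpace (X : Type*) [MetricSpace X] [AddCommMonoid X] [DistribMulAction ℝ X] : Prop where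
  zero_smul : ∀ x : X, (0 : ℝ) • x = 0
  complete : CompleteSpace X
  separable : TopologicalSpace.SeparableSpace X
  dist_smul : ∀ (α : ℝ) (x y : X), dist (α • x) (α • y) = |α| * dist x y
  dist_add_le : ∀ x y z : X, dist (x + z) (y + z) ≤ dist x y

section
variable {X : Type*} [MetricSpace X] [AddCommMonoid X] [DistribMulAction ℝ X]

variable (X) in
/-- `X` is isotropic. -/
def Isotropic : Prop := ∀ x y z : X, dist (x + z) (y + z) = dist x y

variable (X) in
/-- The set `X^c` of convex elements. -/
def convexElements : Set X :=
  {x | ∀ α β : ℝ, 0 ≤ α → 0 ≤ β → (α + β) • x = α • x + β • x}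

variable (X) in
/-- The set `X^inv` of invertible elements. -/
def invertibleElements : Set X := {x | ∃ x' : X, x + x' = 0}

/-- `P` is a convexifying operator: a surjection of `X` onto `X^c` that is nonexpansive,
idempotent and linear. -/
structure IsConvexifying (P : X → X) : Prop where
  range_eq : Set.range P = convexElements X
  dist_le : ∀ x y : X, dist (P x) (P y) ≤ dist x y
  idem : ∀ x : X, P (P x) = P x
  map_lin : ∀ (α β : ℝ) (x y : X), P (α • x + β • y) = α • P x + β • P y

/-- The Lebesgue integral over `[u, v]` of a simple function (measurable, finitely many values):
the sum of `μ(T_k) P(f_k)` over the values `f_k`, `T_k` being the part of `[u, v]` on which the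
function equals `f_k`. -/
def simpleIntegral (P : X → X) (u v : ℝ) (S : SimpleFunc ℝ X) : X :=
  ∑ y ∈ S.range, (volume (Set.Icc u v ∩ S ⁻¹' {y})).toReal • P y

/-- `I` is the integral of `φ` over `[u, v]`: `φ` is on `[u, v]` the uniform limit of simple
functions whose integrals converge to `I`. -/
def HasLIntegral (P : X → X) (φ : ℝ → X) (u v : ℝ) (I : X) : Prop :=
  ∃ S : ℕ → SimpleFunc ℝ X,
    TendstoUniformlyOn (fun n s => S n s) φ atTop (Set.Icc u v) ∧
    Tendsto (fun n => simpleIntegral P u v (S n)) atTop (𝓝 I)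

/-- A modulus of continuity `ω : [0, ∞) → ℝ`: continuous, nondecreasing, semiadditive, and zero
at zero. Values at negative arguments play no role. -/
structure IsModulus (ω : ℝ → ℝ) : Prop where
  zero : ω 0 = 0
  mono : MonotoneOn ω (Set.Ici 0)
  cont : ContinuousOn ω (Set.Ici 0)
  subadd : ∀ s t : ℝ, 0 ≤ s → 0 ≤ t → ω (s + t) ≤ ω s + ω t

/-- `φ` belongs, as a function on `[a, b]`, to the class `H^ω([a, b], X)`. -/
def MemHω (ω : ℝ → ℝ) (a b : ℝ) (φ : ℝ → X) : Prop :=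
  ∀ s ∈ Set.Icc a b, ∀ t ∈ Set.Icc a b, dist (φ s) (φ t) ≤ ω |s - t|

/-- The class `W¹H^ω([a, b], X)` of the functions `f(t) = x + ∫_a^t φ` with `x ∈ X^c` and
`φ ∈ H^ω([a, b], X)`. -/
def W1Hω (P : X → X) (ω : ℝ → ℝ) (a b : ℝ) : Set (Set.Icc a b → X) :=
  {f | ∃ φ : ℝ → X, MemHω ω a b φ ∧ ∃ x ∈ convexElements X,
    ∀ t : Set.Icc a b, ∃ I : X, HasLIntegral P φ a t I ∧ f t = x + I}

/-- The Hukuhara type difference `x -_H y`: the `z` with `x = y + z` if there is one (it is then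
unique when `X` is isotropic), and `0` by convention if there is none. -/
def hDiff (x y : X) : X :=
  open Classical in if h : ∃ z : X, x = y + z then h.choose else 0

/-- The divided difference `(f(t + γ₂) -_H f(t - γ₁)) / (γ₁ + γ₂)`. -/
def hDivDiff (γ₁ γ₂ : ℝ) (f : ℝ → X) (t : ℝ) : X :=
  (γ₁ + γ₂)⁻¹ • hDiff (f (t + γ₂)) (f (t - γ₁))

/-- `z` is the Hukuhara type derivative at `t ∈ [a, b]` of the function `f` on `[a, b]`: both
one-sided limits exist and equal `z`; at an end point of `[a, b]` there is one limit only. -/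
def HasHDeriv (a b : ℝ) (f : ℝ → X) (t : ℝ) (z : X) : Prop :=
  (t < b → (∀ᶠ γ in 𝓝[>] (0 : ℝ), ∃ d : X, f (t + γ) = f t + d) ∧
    Tendsto (fun γ : ℝ => γ⁻¹ • hDiff (f (t + γ)) (f t)) (𝓝[>] 0) (𝓝 z)) ∧
  (a < t → (∀ᶠ γ in 𝓝[>] (0 : ℝ), ∃ d : X, f t = f (t - γ) + d) ∧
    Tendsto (fun γ : ℝ => γ⁻¹ • hDiff (f t) (f (t - γ))) (𝓝[>] 0) (𝓝 z))

/-- The Hukuhara type derivative of `f` at `t` (and `0` by convention if there is none). -/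
def hDeriv (a b : ℝ) (f : ℝ → X) (t : ℝ) : X :=
  open Classical in if h : ∃ z : X, HasHDeriv a b f t z then h.choose else 0

variable (X) in
/-- The cone `C^H([a, b], X)` of the continuous functions on `[a, b]` for which the difference
`f(v) -_H f(u)` exists whenever `u < v`. -/
def CH (a b : ℝ) : Set (Set.Icc a b → X) :=
  {f | Continuous f ∧ ∀ u v : Set.Icc a b, u < v → ∃ z : X, f v = f u + z}

/-- The uniform norm `sup_t h(f(t), θ)`. -/
def supNorm {a b : ℝ} (f : Set.Icc a b → X) : ℝ≥0∞ := ⨆ t, edist (f t) 0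

/-- `T` is positively homogeneous on `C^H([a, b], X)`. -/
def PosHomogeneous {a b : ℝ} (T : CH X a b → X) : Prop :=
  ∀ (α : ℝ) (f g : CH X a b), 0 < α → (∀ t, g.1 t = α • f.1 t) → T g = α • T f

/-- The norm `‖T‖`: the supremum of `‖T f‖` over the `f` with `‖f‖ ≤ 1`. -/
def opNorm {a b : ℝ} (T : CH X a b → X) : ℝ≥0∞ :=
  ⨆ (f : CH X a b) (_ : supNorm f.1 ≤ 1), edist (T f) 0

/-- `T` competes in the approximation problem with bound `N`: it is positively homogeneous and
`‖T‖ ≤ N`. -/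
def Admissible {a b : ℝ} (N : ℝ) (T : CH X a b → X) : Prop :=
  PosHomogeneous T ∧ opNorm T ≤ ENNReal.ofReal N

/-- The deviation `U(A, T)`: the supremum of `h(A f, T f)` over `f ∈ W¹H^ω([a, b], X)`, a class
that is contained in `C^H([a, b], X)`. -/
def deviation (P : X → X) (ω : ℝ → ℝ) {a b : ℝ} (A : (Set.Icc a b → X) → X)
    (T : CH X a b → X) : ℝ≥0∞ :=
  ⨆ (f : CH X a b) (_ : f.1 ∈ W1Hω P ω a b), edist (A f.1) (T f)

/-- The best approximation `E(A, N)` of `A` by operators `T` with `‖T‖ ≤ N`. -/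
def bestApprox (P : X → X) (ω : ℝ → ℝ) {a b : ℝ} (A : (Set.Icc a b → X) → X)
    (N : ℝ) : ℝ≥0∞ :=
  ⨅ (T : CH X a b → X) (_ : Admissible N T), deviation P ω A T

/-- The operator `Δ_{γ₁,γ₂}(t)` on functions on `[a, b]`. Here `IccExtend` only serves to
evaluate `f` at the points `t + γ₂`, `t - γ₁`, which lie in `[a, b]` where this is used. -/
def divDiffOp {a b : ℝ} (hab : a ≤ b) (γ₁ γ₂ t : ℝ) (f : Set.Icc a b → X) : X :=
  hDivDiff γ₁ γ₂ (Set.IccExtend hab f) t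

/-- The operator `D_H(t)` on functions on `[a, b]`. -/
def derivOp {a b : ℝ} (hab : a ≤ b) (t : ℝ) (f : Set.Icc a b → X) : X :=
  hDeriv a b (Set.IccExtend hab f) t

end

/-- `I(α) = ∫_0^α ω`. -/
def Iω (ω : ℝ → ℝ) (α : ℝ) : ℝ := ∫ s in (0 : ℝ)..α, ω s

/-- The constant `K(γ₁, γ₂; h₁, h₂)`; it is `0` when `γ₁ = h₁` and `γ₂ = h₂`. -/
def Kω (ω : ℝ → ℝ) (γ₁ γ₂ h₁ h₂ : ℝ) : ℝ :=
  ((h₁ - γ₁) + (h₂ - γ₂)) / (h₁ + h₂) ^ 2 *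
    (Iω ω ((h₁ + h₂) * (h₁ - γ₁) / ((h₁ - γ₁) + (h₂ - γ₂))) +
      Iω ω ((h₁ + h₂) * (h₂ - γ₂) / ((h₁ - γ₁) + (h₂ - γ₂))))

end

end LSpaces

open LSpaces

namespace LSpaces

open scoped NNReal

universe u

/-! The convex elements form a cone with cancellation in which translations are isometries, so a
Rådström type construction embeds them isometrically in a Banach space `E`
(`exists_isConvexEmbedding`). The map `ι` is defined on all of `X` and does not distinguish `x` from
`P x`. Hence it turns the integral of `X` into the Bochner integral, and a function of the class
into a primitive of some `Ψ : ℝ → E` with modulus `ω`. The image of the cone is closed and convex,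
so means of `Ψ` stay in it. Therefore Hukuhara differences exist and correspond to `∫ Ψ`
(`IsEmbeddedDeriv.hDiff_spec`), and the Hukuhara derivative corresponds to `Ψ t`.

Upper bound: the deviation is now a difference of two means of `Ψ` over nested intervals, or of `Ψ
t` and a mean. Moving the excess mass of the inner mean linearly onto the two outer pieces
(`average_sub_average`, `sub_average`) writes it as an integral of differences `Ψ x - Ψ y`, each of
which is at most `ω |x - y|`.

Lower bound: an invertible convex element spans an isometric copy `J` of the real line. For a
nonnegative `ψ` with modulus `ω` that vanishes on `[a, b]` outside `[t - h₁, t + h₂]`, put `f = J (c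
+ ∫ ψ)` and `m = ∫ ψ` over `[t - h₁, t + h₂]`. A suitable `c` gives `‖f‖ ≤ m / 2`, so every
admissible `T` has `‖T f‖ ≤ m / (h₁ + h₂)`, while `A f` is known exactly (`le_bestApprox`). What
remains is to find `ψ` with equality in all estimates of the upper bound. For the derivative it is a
truncation of `ω h - ω |s - t|`. For divided differences it is assembled from rescaled copies of
`ω`, and concavity is what keeps its modulus below `ω` (`branch_sub_le`). -/

theorem exists_linearMap_norm_eq_seminorm {V : Type u} [AddCommGroup V] [Module ℝ V]
    (p : Seminorm ℝ V) :
    ∃ (E : Type u) (_ : NormedAddCommGroup E) (_ : NormedSpace ℝ E) (_ : CompleteSpace E)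
      (L : V →ₗ[ℝ] E), ∀ v, ‖L v‖ = p v := by
  let _ : SeminormedAddCommGroup V := p.toAddGroupSeminorm.toSeminormedAddCommGroup
  let _ : NormedSpace ℝ V := ⟨fun r v => (map_smul_eq_mul p r v).le⟩
  exact ⟨UniformSpace.Completion V, inferInstance, inferInstance, inferInstance,
    (UniformSpace.Completion.toComplₗᵢ (𝕜 := ℝ) (E := V)).toLinearMap,
    fun v => UniformSpace.Completion.norm_coe v⟩

/-! ### Cancellation in isotropic spaces and the Rådström type embedding -/

section
variable {X : Type u} [MetricSpace X] [AddCommMonoid X] [DistribMulAction ℝ X]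

theorem Isotropic.dist_add_left (hiso : Isotropic X) (x y z : X) :
    dist (z + x) (z + y) = dist x y := by
  rw [add_comm z, add_comm z, hiso]

theorem Isotropic.add_left_cancel (hiso : Isotropic X) {x y z : X} (h : z + x = z + y) :
    x = y := by
  rw [← dist_eq_zero, ← hiso.dist_add_left x y z, h, dist_self]

theorem Isotropic.dist_add_add_le (hiso : Isotropic X) (x y z w : X) :
    dist (x + y) (z + w) ≤ dist x z + dist y w := by
  have := dist_triangle (x + y) (z + y) (z + w)
  rwa [hiso, hiso.dist_add_left] at this

theorem Isotropic.dist_add_self (hiso : Isotropic X) (x z : X) :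
    dist (x + z) x = dist z 0 := by
  conv_lhs => rw [← add_zero x, add_assoc, zero_add]
  exact hiso.dist_add_left _ _ _

variable {P : X → X}

theorem IsConvexifying.map_add (hP : IsConvexifying P) (x y : X) : P (x + y) = P x + P y := by
  simpa using hP.map_lin 1 1 x y

theorem IsConvexifying.map_zero [LSpace X] (hP : IsConvexifying P) : P 0 = 0 := by
  simpa [LSpace.zero_smul] using hP.map_lin 0 0 0 0

theorem IsConvexifying.map_smul [LSpace X] (hP : IsConvexifying P) (α : ℝ) (x : X) :
    P (α • x) = α • P x := by
  simpa [LSpace.zero_smul] using hP.map_lin α 0 x 0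

theorem IsConvexifying.mem_convexElements_iff (hP : IsConvexifying P) {x : X} :
    x ∈ convexElements X ↔ P x = x := by
  rw [← hP.range_eq]
  exact ⟨by rintro ⟨y, rfl⟩; exact hP.idem y, fun h => ⟨x, h⟩⟩

theorem IsConvexifying.add_smul (hP : IsConvexifying P) {α β : ℝ} (hα : 0 ≤ α) (hβ : 0 ≤ β)
    (x : X) : (α + β) • P x = α • P x + β • P x :=
  (hP.mem_convexElements_iff.2 (hP.idem x)) α β hα hβ

theorem IsConvexifying.lipschitz (hP : IsConvexifying P) : LipschitzWith 1 P :=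
  LipschitzWith.of_dist_le_mul fun x y => by simpa using hP.dist_le x y

theorem IsConvexifying.isClosed_convexElements (hP : IsConvexifying P) :
    IsClosed (convexElements X) := by
  have : convexElements X = {x | P x = x} := by
    ext x; exact hP.mem_convexElements_iff
  rw [this]
  exact isClosed_eq hP.lipschitz.continuous continuous_id

/-- The sum `∑ u_x P(x)` of a finitely supported family of nonnegative coefficients. -/
noncomputable def convexSum [LSpace X] (hP : IsConvexifying P) : (X →₀ ℝ≥0) →+ X :=
  Finsupp.liftAddHom fun x =>
    { toFun := fun r => (r : ℝ) • P x
      map_zero' := by simpa using LSpace.zero_smul (P x)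
      map_add' := fun r s => by
        rw [NNReal.coe_add, hP.add_smul r.coe_nonneg s.coe_nonneg] }

theorem convexSum_single [LSpace X] (hP : IsConvexifying P) (x : X) (r : ℝ≥0) :
    convexSum hP (Finsupp.single x r) = (r : ℝ) • P x := by
  rw [convexSum, Finsupp.liftAddHom_apply_single]
  rfl

theorem convexSum_smul [LSpace X] (hP : IsConvexifying P) (r : ℝ≥0) (u : X →₀ ℝ≥0) :
    convexSum hP (r • u) = (r : ℝ) • convexSum hP u := by
  induction u using Finsupp.induction_linear with
  | zero => simp
  | add u v hu hv => rw [smul_add, _root_.map_add, _root_.map_add, hu, hv, smul_add]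
  | single x s => rw [Finsupp.smul_single, convexSum_single, convexSum_single, smul_eq_mul,
      NNReal.coe_mul, mul_smul]

/-- The positive part of a finitely supported family of real coefficients. -/
noncomputable def finsuppPos (c : X →₀ ℝ) : X →₀ ℝ≥0 := c.mapRange Real.toNNReal (by simp)

/-- The seminorm `dist (∑ c_x⁺ P(x)) (∑ c_x⁻ P(x))` on the free vector space over `X`. -/
noncomputable def freeGauge [LSpace X] (hP : IsConvexifying P) (c : X →₀ ℝ) : ℝ :=
  dist (convexSum hP (finsuppPos c)) (convexSum hP (finsuppPos (-c)))

/-- If `c = u - v`, then `u + c⁻ = v + c⁺`. Adding a common element changes no distance in an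
isotropic space, so every representation of `c` as a difference gives the same value. Subadditivity
and homogeneity of the gauge, and the properties of the embedding, follow by choosing convenient
representations. -/
theorem freeGauge_eq [LSpace X] (hiso : Isotropic X) (hP : IsConvexifying P) (c : X →₀ ℝ)
    (u v : X →₀ ℝ≥0) (h : ∀ x, c x = u x - v x) :
    freeGauge hP c = dist (convexSum hP u) (convexSum hP v) := by
  have key : u + finsuppPos (-c) = v + finsuppPos c := by
    ext x
    simp only [finsuppPos, Finsupp.add_apply, Finsupp.mapRange_apply, Finsupp.neg_apply,
      NNReal.coe_add, Real.coe_toNNReal', h x]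
    rcases le_total (u x : ℝ) (v x) with hx | hx
    · rw [max_eq_left (by linarith), max_eq_right (by linarith)]; ring
    · rw [max_eq_right (by linarith), max_eq_left (by linarith)]; ring
  rw [← hiso _ _ (convexSum hP (finsuppPos (-c))), ← _root_.map_add, key, _root_.map_add,
    hiso.dist_add_left]
  rfl

theorem finsuppPos_sub (c : X →₀ ℝ) (x : X) :
    c x = (finsuppPos c x : ℝ) - finsuppPos (-c) x := by
  simp only [finsuppPos, Finsupp.mapRange_apply, Finsupp.neg_apply, Real.coe_toNNReal']
  rcases le_total (c x) 0 with hx | hx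
  · rw [max_eq_right hx, max_eq_left (by linarith)]; ring
  · rw [max_eq_left hx, max_eq_right (by linarith)]; ring

/-- `freeGauge` as a seminorm. -/
noncomputable def freeSeminorm [LSpace X] (hiso : Isotropic X) (hP : IsConvexifying P) :
    Seminorm ℝ (X →₀ ℝ) :=
  Seminorm.of (freeGauge hP)
    (fun c d => by
      rw [freeGauge_eq hiso hP (c + d) (finsuppPos c + finsuppPos d)
        (finsuppPos (-c) + finsuppPos (-d))]
      · rw [_root_.map_add, _root_.map_add]
        exact hiso.dist_add_add_le _ _ _ _
      · intro x
        simp only [Finsupp.add_apply, NNReal.coe_add, finsuppPos_sub c x, finsuppPos_sub d x]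
        ring)
    (fun r c => by
      rcases le_total 0 r with hr | hr
      · rw [freeGauge_eq hiso hP (r • c) (r.toNNReal • finsuppPos c)
          (r.toNNReal • finsuppPos (-c))]
        · rw [convexSum_smul, convexSum_smul, LSpace.dist_smul, Real.coe_toNNReal _ hr]
          rfl
        · intro x
          simp only [Finsupp.smul_apply, smul_eq_mul, NNReal.coe_mul, Real.coe_toNNReal _ hr]
          rw [finsuppPos_sub c x]; ring
      · rw [freeGauge_eq hiso hP (r • c) ((-r).toNNReal • finsuppPos (-c))
          ((-r).toNNReal • finsuppPos c)]
        · rw [convexSum_smul, convexSum_smul, LSpace.dist_smul,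
            Real.coe_toNNReal _ (neg_nonneg.2 hr), abs_neg, dist_comm]
          rfl
        · intro x
          simp only [Finsupp.smul_apply, smul_eq_mul, NNReal.coe_mul,
            Real.coe_toNNReal _ (neg_nonneg.2 hr)]
          rw [finsuppPos_sub c x]; ring)

/-- A map of `X` to a vector space that is additive and nonnegatively homogeneous, and isometric
on the convex elements. -/
structure IsConvexEmbedding {E : Type*} [NormedAddCommGroup E] [NormedSpace ℝ E] (P : X → X)
    (ι : X → E) : Prop where
  map_add : ∀ x y, ι (x + y) = ι x + ι y
  map_smul : ∀ (α : ℝ) (x), 0 ≤ α → ι (α • x) = α • ι x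
  dist_eq : ∀ x y, dist (ι x) (ι y) = dist (P x) (P y)

/-- The point mass at `x` is sent to the completed quotient of the free vector space by the null
vectors of the gauge. Additivity and homogeneity hold because the corresponding combinations of
point masses have gauge zero. -/
theorem exists_isConvexEmbedding [LSpace X] (hiso : Isotropic X) (hP : IsConvexifying P) :
    ∃ (E : Type u) (_ : NormedAddCommGroup E) (_ : NormedSpace ℝ E) (_ : CompleteSpace E)
      (ι : X → E), IsConvexEmbedding P ι := by
  classical
  obtain ⟨E, i1, i2, i3, L, hL⟩ := exists_linearMap_norm_eq_seminorm (freeSeminorm hiso hP)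
  have hL' : ∀ c, ‖L c‖ = freeGauge hP c := hL
  refine ⟨E, i1, i2, i3, fun x => L (Finsupp.single x 1), fun x y => ?_, fun α x hα => ?_,
    fun x y => ?_⟩
  · rw [← sub_eq_zero, ← norm_eq_zero, ← _root_.map_add, ← _root_.map_sub, hL',
      freeGauge_eq hiso hP _ (Finsupp.single (x + y) 1)
        (Finsupp.single x 1 + Finsupp.single y 1)]
    · simp [convexSum_single, hP.map_add]
    · intro z
      simp only [Finsupp.sub_apply, Finsupp.add_apply, Finsupp.single_apply]
      split_ifs <;> simp
  · rw [← sub_eq_zero, ← norm_eq_zero, ← _root_.map_smul, ← _root_.map_sub, hL',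
      freeGauge_eq hiso hP _ (Finsupp.single (α • x) 1)
        (Finsupp.single x α.toNNReal)]
    · simp [convexSum_single, hP.map_smul, hα]
    · intro z
      simp only [Finsupp.sub_apply, Finsupp.smul_apply, Finsupp.single_apply]
      split_ifs <;> simp [hα]
  · rw [dist_eq_norm, ← _root_.map_sub, hL',
      freeGauge_eq hiso hP _ (Finsupp.single x 1) (Finsupp.single y 1)]
    · simp [convexSum_single]
    · intro z
      simp only [Finsupp.sub_apply, Finsupp.single_apply]
      split_ifs <;> simp

end

/-! ### Integrals, Hukuhara differences and derivatives seen through the embedding -/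

section
variable {X : Type*} [MetricSpace X] [AddCommMonoid X] [DistribMulAction ℝ X] {P : X → X}

theorem IsModulus.continuous_abs {ω : ℝ → ℝ} (hω : IsModulus ω) : Continuous fun s => ω |s| :=
  hω.cont.comp_continuous _root_.continuous_abs fun s => abs_nonneg s

theorem IsModulus.continuous_of_dist_le {Y : Type*} [PseudoMetricSpace Y] {ω : ℝ → ℝ}
    (hω : IsModulus ω) {Ψ : ℝ → Y} (h : ∀ s t, dist (Ψ s) (Ψ t) ≤ ω |s - t|) :
    Continuous Ψ := by
  rw [continuous_iff_continuousAt]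
  intro t
  rw [ContinuousAt, tendsto_iff_dist_tendsto_zero]
  have h0 : Tendsto (fun s => ω |s - t|) (𝓝 t) (𝓝 0) := by
    have := (hω.continuous_abs.comp (continuous_id.sub (continuous_const (y := t)))).tendsto t
    simpa [hω.zero, Function.comp_def] using this
  exact squeeze_zero (fun _ => dist_nonneg) (fun s => h s t) h0

theorem IsConvexifying.zero_mem [LSpace X] (hP : IsConvexifying P) : (0 : X) ∈ convexElements X :=
  hP.mem_convexElements_iff.2 hP.map_zero

theorem IsConvexifying.add_mem (hP : IsConvexifying P) {x y : X}
    (hx : x ∈ convexElements X) (hy : y ∈ convexElements X) : x + y ∈ convexElements X := by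
  rw [hP.mem_convexElements_iff] at *
  rw [hP.map_add, hx, hy]

theorem IsConvexifying.smul_mem [LSpace X] (hP : IsConvexifying P) (α : ℝ) {x : X}
    (hx : x ∈ convexElements X) : α • x ∈ convexElements X := by
  rw [hP.mem_convexElements_iff] at *
  rw [hP.map_smul, hx]

theorem IsConvexifying.simpleIntegral_mem [LSpace X] (hP : IsConvexifying P) (u v : ℝ)
    (S : SimpleFunc ℝ X) : simpleIntegral P u v S ∈ convexElements X := by
  classical
  unfold simpleIntegral
  induction S.range using Finset.induction_on with
  | empty => simpa using hP.zero_mem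
  | insert y s hy ih =>
    rw [Finset.sum_insert hy]
    exact hP.add_mem (hP.smul_mem _ (hP.mem_convexElements_iff.2 (hP.idem y))) ih

variable {E : Type*} [NormedAddCommGroup E] [NormedSpace ℝ E] {ι : X → E}

theorem IsConvexEmbedding.map_zero [LSpace X] (hι : IsConvexEmbedding P ι) : ι 0 = 0 := by
  simpa [LSpace.zero_smul] using hι.map_smul 0 0 le_rfl

theorem IsConvexEmbedding.map_apply (hι : IsConvexEmbedding P ι) (hP : IsConvexifying P) (x : X) :
    ι (P x) = ι x := by
  rw [← dist_eq_zero, hι.dist_eq, hP.idem, dist_self]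

theorem IsConvexEmbedding.dist_eq_of_mem (hι : IsConvexEmbedding P ι) (hP : IsConvexifying P)
    {x y : X} (hx : x ∈ convexElements X) (hy : y ∈ convexElements X) :
    dist (ι x) (ι y) = dist x y := by
  rw [hι.dist_eq, hP.mem_convexElements_iff.1 hx, hP.mem_convexElements_iff.1 hy]

theorem IsConvexEmbedding.dist_le (hι : IsConvexEmbedding P ι) (hP : IsConvexifying P)
    (x y : X) : dist (ι x) (ι y) ≤ dist x y := (hι.dist_eq x y).trans_le (hP.dist_le x y)

theorem IsConvexEmbedding.continuous (hι : IsConvexEmbedding P ι) (hP : IsConvexifying P) :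
    Continuous ι :=
  (LipschitzWith.of_dist_le_mul fun x y => by simpa using hι.dist_le hP x y :
    LipschitzWith 1 ι).continuous

theorem IsConvexEmbedding.map_sum [LSpace X] (hι : IsConvexEmbedding P ι) {κ : Type*}
    (s : Finset κ) (g : κ → X) : ι (∑ i ∈ s, g i) = ∑ i ∈ s, ι (g i) := by
  classical
  induction s using Finset.induction_on with
  | empty => simp [hι.map_zero]
  | insert y s hy ih => rw [Finset.sum_insert hy, Finset.sum_insert hy, hι.map_add, ih]

theorem IsConvexEmbedding.isClosed_image [LSpace X] (hι : IsConvexEmbedding P ι)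
    (hP : IsConvexifying P) : IsClosed (ι '' convexElements X) := by
  have := LSpace.complete (X := X)
  have hc := hP.isClosed_convexElements.completeSpace_coe
  have hi : Isometry fun x : convexElements X => ι x :=
    Isometry.of_dist_eq fun x y => hι.dist_eq_of_mem hP x.2 y.2
  rw [image_eq_range]
  exact hi.isClosedEmbedding.isClosed_range

theorem IsConvexEmbedding.convex_image [LSpace X] (hι : IsConvexEmbedding P ι)
    (hP : IsConvexifying P) : Convex ℝ (ι '' convexElements X) := by
  rintro _ ⟨x, hx, rfl⟩ _ ⟨y, hy, rfl⟩ r s hr hs -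
  exact ⟨r • x + s • y, hP.add_mem (hP.smul_mem r hx) (hP.smul_mem s hy), by
    rw [hι.map_add, hι.map_smul _ _ hr, hι.map_smul _ _ hs]⟩

theorem IsConvexEmbedding.map_simpleIntegral [LSpace X] [CompleteSpace E]
    (hι : IsConvexEmbedding P ι)
    (hP : IsConvexifying P) (u v : ℝ) (S : SimpleFunc ℝ X) :
    ι (simpleIntegral P u v S) = ∫ s in Icc u v, ι (S s) := by
  have h1 : (fun s => ι (S s)) =
      fun s => ∑ y ∈ S.range, (S ⁻¹' {y}).indicator (fun _ => ι y) s := by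
    funext s
    rw [Finset.sum_eq_single (S s)]
    · rw [indicator_of_mem (show s ∈ S ⁻¹' {S s} from rfl)]
    · intro y _ hy
      rw [indicator_of_notMem]
      exact fun h => hy (Eq.symm h)
    · intro h
      exact absurd (S.mem_range_self s) h
  rw [h1, integral_finsetSum]
  · unfold simpleIntegral
    rw [hι.map_sum]
    refine Finset.sum_congr rfl fun y _ => ?_
    rw [integral_indicator_const _ (S.measurableSet_fiber y), measureReal_restrict_apply
      (S.measurableSet_fiber y), hι.map_smul _ _ ENNReal.toReal_nonneg, hι.map_apply hP,
      inter_comm]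
    rfl
  · intro y _
    exact (integrable_const (ι y)).indicator (S.measurableSet_fiber y)

theorem IsConvexEmbedding.tendsto_simpleIntegral [LSpace X] [CompleteSpace E]
    (hι : IsConvexEmbedding P ι)
    (hP : IsConvexifying P) {u v : ℝ} {φ : ℝ → X} {S : ℕ → SimpleFunc ℝ X}
    (hφ : ContinuousOn (fun s => ι (φ s)) (Icc u v))
    (hS : TendstoUniformlyOn (fun n s => S n s) φ atTop (Icc u v)) :
    Tendsto (fun n => ι (simpleIntegral P u v (S n))) atTop (𝓝 (∫ s in Icc u v, ι (φ s))) := by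
  simp_rw [hι.map_simpleIntegral hP]
  rw [Metric.tendsto_atTop]
  intro ε hε
  have hV : 0 ≤ volume.real (Icc u v) := measureReal_nonneg
  have hδ : 0 < ε / (volume.real (Icc u v) + 1) := by positivity
  obtain ⟨N, hN⟩ := eventually_atTop.1 (Metric.tendstoUniformlyOn_iff.1 hS _ hδ)
  refine ⟨N, fun n hn => ?_⟩
  have hi : IntegrableOn (fun s => ι (S n s)) (Icc u v) :=
    ((S n).map ι).integrable_of_isFiniteMeasure
  rw [dist_eq_norm, ← integral_sub hi (hφ.integrableOn_Icc)]
  have hle : ‖∫ s in Icc u v, (ι (S n s) - ι (φ s))‖ ≤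
      ε / (volume.real (Icc u v) + 1) * volume.real (Icc u v) := by
    refine norm_setIntegral_le_of_norm_le_const measure_Icc_lt_top fun s hs => ?_
    rw [← dist_eq_norm, dist_comm]
    exact (hι.dist_le hP _ _).trans (hN n hn s hs).le
  refine hle.trans_lt ?_
  rw [div_mul_eq_mul_div, div_lt_iff₀ (by positivity)]
  nlinarith

theorem HasLIntegral.mem_convexElements [LSpace X] (hP : IsConvexifying P) {u v : ℝ} {φ : ℝ → X}
    {I : X} (h : HasLIntegral P φ u v I) : I ∈ convexElements X := by
  obtain ⟨S, -, hI⟩ := h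
  exact hP.isClosed_convexElements.mem_of_tendsto hI
    (Eventually.of_forall fun n => hP.simpleIntegral_mem u v (S n))

theorem HasLIntegral.map_eq [LSpace X] [CompleteSpace E] (hι : IsConvexEmbedding P ι)
    (hP : IsConvexifying P) {u v : ℝ} {φ : ℝ → X} {I : X} (h : HasLIntegral P φ u v I)
    (hφ : ContinuousOn (fun s => ι (φ s)) (Icc u v)) :
    ι I = ∫ s in Icc u v, ι (φ s) := by
  obtain ⟨S, hS, hI⟩ := h
  exact tendsto_nhds_unique (((hι.continuous hP).tendsto I).comp hI)
    (hι.tendsto_simpleIntegral hP hφ hS)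

/-- `Ψ` is, on the whole line, the image in `E` of the Hukuhara type derivative of a function `f`
of the class `W¹H^ω([a, b], X)`. -/
structure IsEmbeddedDeriv (ι : X → E) (ω : ℝ → ℝ) {a b : ℝ} (f : Icc a b → X) (Ψ : ℝ → E) :
    Prop where
  norm_sub_le : ∀ s t, ‖Ψ s - Ψ t‖ ≤ ω |s - t|
  mem_image : ∀ s, Ψ s ∈ ι '' convexElements X
  mem_convexElements : ∀ u, f u ∈ convexElements X
  sub_eq : ∀ u v, ι (f v) - ι (f u) = ∫ s in u.1..v.1, Ψ s

theorem exists_isEmbeddedDeriv [LSpace X] [CompleteSpace E] (hι : IsConvexEmbedding P ι)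
    (hP : IsConvexifying P) {ω : ℝ → ℝ} (hω : IsModulus ω) {a b : ℝ} (hab : a ≤ b)
    {f : Icc a b → X} (hf : f ∈ W1Hω P ω a b) : ∃ Ψ : ℝ → E, IsEmbeddedDeriv ι ω f Ψ := by
  obtain ⟨φ, hφ, x, hx, hfx⟩ := hf
  -- `φ` is controlled on `[a, b]` only. Composing with the projection onto `[a, b]`, which is
  -- nonexpansive, extends it to the line with the same modulus.
  have hΨ : ∀ s t, dist (ι (φ (projIcc a b hab s))) (ι (φ (projIcc a b hab t))) ≤
      ω |s - t| := fun s t =>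
    ((hι.dist_le hP _ _).trans (hφ _ (projIcc a b hab s).2 _ (projIcc a b hab t).2)).trans
      (hω.mono (mem_Ici.2 (abs_nonneg _)) (mem_Ici.2 (abs_nonneg _)) (abs_projIcc_sub_projIcc hab))
  have hcont := hω.continuous_of_dist_le hΨ
  have hval : ∀ u : Icc a b, f u ∈ convexElements X ∧
      ι (f u) = ι x + ∫ s in a..u.1, ι (φ (projIcc a b hab s)) := by
    intro u
    obtain ⟨I, hI, hu⟩ := hfx u
    have hc : EqOn (fun s => ι (φ s)) (fun s => ι (φ (projIcc a b hab s))) (Icc a u.1) :=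
      fun s hs => by
        simp only [projIcc_of_mem hab ⟨hs.1, hs.2.trans u.2.2⟩]
    refine ⟨hu ▸ hP.add_mem hx (hI.mem_convexElements hP), ?_⟩
    rw [hu, hι.map_add, hI.map_eq hι hP (hcont.continuousOn.congr hc),
      intervalIntegral.integral_of_le u.2.1, ← integral_Icc_eq_integral_Ioc]
    rw [setIntegral_congr_fun measurableSet_Icc hc]
  refine ⟨fun s => ι (φ (projIcc a b hab s)), fun s t => ?_, fun s => ?_, fun u => (hval u).1,
    fun u v => ?_⟩
  · rw [← dist_eq_norm]; exact hΨ s t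
  · exact ⟨P (φ (projIcc a b hab s)), hP.mem_convexElements_iff.2 (hP.idem _),
      hι.map_apply hP _⟩
  · rw [(hval u).2, (hval v).2, add_sub_add_left_eq_sub,
      intervalIntegral.integral_interval_sub_left]
    · exact hcont.intervalIntegrable _ _
    · exact hcont.intervalIntegrable _ _

theorem Isotropic.hDiff_eq (hiso : Isotropic X) {x y z : X} (h : x = y + z) : hDiff x y = z := by
  have hex : ∃ z : X, x = y + z := ⟨z, h⟩
  rw [hDiff, dif_pos hex]
  exact hiso.add_left_cancel (hex.choose_spec.symm.trans h)

theorem IsEmbeddedDeriv.continuous {ω : ℝ → ℝ} (hω : IsModulus ω)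
    {a b : ℝ} {f : Icc a b → X} {Ψ : ℝ → E} (h : IsEmbeddedDeriv ι ω f Ψ) : Continuous Ψ :=
  hω.continuous_of_dist_le fun s t => by rw [dist_eq_norm]; exact h.norm_sub_le s t

/-- The mean of `Ψ` over `[u, v]` lies in the closed convex set `ι '' convexElements X`. Its
preimage multiplied by `v - u` is the required difference, since `ι` is isometric on convex elements
and so reflects the identity `f v = f u + z`. -/
theorem IsEmbeddedDeriv.hDiff_spec [LSpace X] [CompleteSpace E] (hiso : Isotropic X)
    (hι : IsConvexEmbedding P ι) (hP : IsConvexifying P) {ω : ℝ → ℝ} (hω : IsModulus ω)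
    {a b : ℝ} {f : Icc a b → X} {Ψ : ℝ → E} (h : IsEmbeddedDeriv ι ω f Ψ) {u v : Icc a b}
    (huv : u ≤ v) :
    hDiff (f v) (f u) ∈ convexElements X ∧ f v = f u + hDiff (f v) (f u) ∧
      ι (hDiff (f v) (f u)) = ∫ s in u.1..v.1, Ψ s := by
  obtain ⟨z, hz, hzι⟩ : ∃ z ∈ convexElements X, ι z = ∫ s in u.1..v.1, Ψ s := by
    rcases huv.eq_or_lt with rfl | huv
    · exact ⟨0, hP.zero_mem, by simp [hι.map_zero]⟩
    · have huv' : u.1 < v.1 := huv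
      have hm : (⨍ s in Ioc u.1 v.1, Ψ s) ∈ ι '' convexElements X := by
        refine (hι.convex_image hP).set_average_mem (hι.isClosed_image hP) ?_ ?_ ?_ ?_
        · simpa using huv'
        · simp
        · exact Eventually.of_forall h.mem_image
        · exact (h.continuous hω).integrableOn_Ioc
      obtain ⟨y, hy, hyι⟩ := hm
      refine ⟨(v.1 - u.1) • y, hP.smul_mem _ hy, ?_⟩
      rw [hι.map_smul _ _ (sub_nonneg.2 huv'.le), hyι, setAverage_eq,
        intervalIntegral.integral_of_le huv'.le, Real.volume_real_Ioc_of_le huv'.le, smul_smul,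
        mul_inv_cancel₀ (sub_pos.2 huv').ne', one_smul]
  have hfz : f v = f u + z := by
    rw [← dist_eq_zero, ← hι.dist_eq_of_mem hP (h.mem_convexElements v)
      (hP.add_mem (h.mem_convexElements u) hz), hι.map_add, hzι, ← h.sub_eq u v, dist_eq_zero]
    abel
  rw [hiso.hDiff_eq hfz]
  exact ⟨hz, hfz, hzι⟩

theorem IsEmbeddedDeriv.mem_CH [LSpace X] [CompleteSpace E] (hiso : Isotropic X)
    (hι : IsConvexEmbedding P ι) (hP : IsConvexifying P) {ω : ℝ → ℝ} (hω : IsModulus ω)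
    {a b : ℝ} {f : Icc a b → X} {Ψ : ℝ → E} (h : IsEmbeddedDeriv ι ω f Ψ) : f ∈ CH X a b := by
  refine ⟨?_, fun u v huv => ⟨_, (h.hDiff_spec hiso hι hP hω huv.le).2.1⟩⟩
  rw [continuous_iff_continuousAt]
  intro u
  rw [ContinuousAt, tendsto_iff_dist_tendsto_zero]
  have heq : ∀ v, dist (f v) (f u) = ‖∫ s in u.1..v.1, Ψ s‖ := fun v => by
    rw [← h.sub_eq, ← dist_eq_norm,
      hι.dist_eq_of_mem hP (h.mem_convexElements v) (h.mem_convexElements u)]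
  simp_rw [heq]
  have hc : Continuous fun v : Icc a b => ‖∫ s in u.1..v.1, Ψ s‖ :=
    ((intervalIntegral.continuous_primitive
      (fun c d => (h.continuous hω).intervalIntegrable c d) u.1).comp
        continuous_subtype_val).norm
  simpa using hc.tendsto u

/-- Distances between convex elements can be computed in `E`, where the Hukuhara quotients are
ordinary difference quotients of a primitive of `Ψ`. The claim is then the fundamental theorem of
calculus. -/
theorem IsEmbeddedDeriv.hasHDeriv [LSpace X] [CompleteSpace E] (hiso : Isotropic X)
    (hι : IsConvexEmbedding P ι) (hP : IsConvexifying P) {ω : ℝ → ℝ} (hω : IsModulus ω)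
    {a b : ℝ} (hab : a ≤ b) {f : Icc a b → X} {Ψ : ℝ → E} (h : IsEmbeddedDeriv ι ω f Ψ) {t : ℝ}
    (ht : t ∈ Icc a b) {z : X} (hz : z ∈ convexElements X) (hzt : ι z = Ψ t) :
    HasHDeriv a b (IccExtend hab f) t z := by
  have hd := (intervalIntegral.integral_hasDerivAt_right
    ((h.continuous hω).intervalIntegrable t t) ((h.continuous hω).stronglyMeasurableAtFilter _ _)
      (h.continuous hω).continuousAt)
  refine ⟨fun htb => ?_, fun hat => ?_⟩
  · have hev : ∀ᶠ γ in 𝓝[>] (0 : ℝ), γ ∈ Ioo 0 (b - t) :=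
      Ioo_mem_nhdsGT (sub_pos.2 htb)
    have key : ∀ γ ∈ Ioo 0 (b - t), ∃ d ∈ convexElements X,
        hDiff (IccExtend hab f (t + γ)) (IccExtend hab f t) = d ∧
        IccExtend hab f (t + γ) = IccExtend hab f t + d ∧ ι d = ∫ s in t..t + γ, Ψ s := by
      rintro γ ⟨h0, h1⟩
      have hm : t + γ ∈ Icc a b := ⟨by linarith [ht.1], by linarith⟩
      rw [IccExtend_of_mem hab f hm, IccExtend_of_mem hab f ht]
      have := h.hDiff_spec hiso hι hP hω (u := ⟨t, ht⟩) (v := ⟨t + γ, hm⟩)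
        (by rw [Subtype.mk_le_mk]; linarith)
      exact ⟨_, this.1, rfl, this.2.1, this.2.2⟩
    refine ⟨hev.mono fun γ hγ => ?_, ?_⟩
    · obtain ⟨d, -, -, h1, -⟩ := key γ hγ
      exact ⟨d, h1⟩
    · rw [tendsto_iff_dist_tendsto_zero]
      have hs := (tendsto_iff_dist_tendsto_zero.1 hd.tendsto_slope_zero_right)
      refine hs.congr' (hev.mono fun γ hγ => ?_)
      obtain ⟨d, hdm, h1, -, h2⟩ := key γ hγ
      dsimp only [Function.comp]
      rw [h1, ← hι.dist_eq_of_mem hP (hP.smul_mem _ hdm) hz, hι.map_smul _ _ (inv_nonneg.2 hγ.1.le),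
        h2, hzt]
      simp
  · have hev : ∀ᶠ γ in 𝓝[>] (0 : ℝ), γ ∈ Ioo 0 (t - a) :=
      Ioo_mem_nhdsGT (sub_pos.2 hat)
    have key : ∀ γ ∈ Ioo 0 (t - a), ∃ d ∈ convexElements X,
        hDiff (IccExtend hab f t) (IccExtend hab f (t - γ)) = d ∧
        IccExtend hab f t = IccExtend hab f (t - γ) + d ∧ ι d = ∫ s in t - γ..t, Ψ s := by
      rintro γ ⟨h0, h1⟩
      have hm : t - γ ∈ Icc a b := ⟨by linarith, by linarith [ht.2]⟩
      rw [IccExtend_of_mem hab f hm, IccExtend_of_mem hab f ht]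
      have := h.hDiff_spec hiso hι hP hω (u := ⟨t - γ, hm⟩) (v := ⟨t, ht⟩)
        (by rw [Subtype.mk_le_mk]; linarith)
      exact ⟨_, this.1, rfl, this.2.1, this.2.2⟩
    refine ⟨hev.mono fun γ hγ => ?_, ?_⟩
    · obtain ⟨d, -, -, h1, -⟩ := key γ hγ
      exact ⟨d, h1⟩
    · rw [tendsto_iff_dist_tendsto_zero]
      have hneg : Tendsto (fun γ : ℝ => -γ) (𝓝[>] 0) (𝓝[<] 0) := by
        simpa using tendsto_neg_nhdsGT (a := (0 : ℝ))
      have hs := (tendsto_iff_dist_tendsto_zero.1 (hd.tendsto_slope_zero_left.comp hneg))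
      refine hs.congr' (hev.mono fun γ hγ => ?_)
      obtain ⟨d, hdm, h1, -, h2⟩ := key γ hγ
      dsimp only [Function.comp]
      rw [h1, ← hι.dist_eq_of_mem hP (hP.smul_mem _ hdm) hz, hι.map_smul _ _ (inv_nonneg.2 hγ.1.le),
        h2, hzt]
      simp only [intervalIntegral.integral_same, sub_zero, ← sub_eq_add_neg,
        inv_neg, neg_smul]
      rw [intervalIntegral.integral_symm, smul_neg, neg_neg]

theorem HasHDeriv.hDeriv_eq {a b : ℝ} (hab : a < b) {f : ℝ → X} {t : ℝ} {z : X}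
    (h : HasHDeriv a b f t z) : hDeriv a b f t = z := by
  have hex : ∃ z : X, HasHDeriv a b f t z := ⟨z, h⟩
  rw [hDeriv, dif_pos hex]
  have h' := hex.choose_spec
  rcases lt_or_ge t b with htb | htb
  · exact tendsto_nhds_unique (h'.1 htb).2 (h.1 htb).2
  · exact tendsto_nhds_unique (h'.2 (hab.trans_le htb)).2 (h.2 (hab.trans_le htb)).2

theorem IsEmbeddedDeriv.derivOp_spec [LSpace X] [CompleteSpace E] (hiso : Isotropic X)
    (hι : IsConvexEmbedding P ι) (hP : IsConvexifying P) {ω : ℝ → ℝ} (hω : IsModulus ω)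
    {a b : ℝ} (hab : a < b) {f : Icc a b → X} {Ψ : ℝ → E} (h : IsEmbeddedDeriv ι ω f Ψ) {t : ℝ}
    (ht : t ∈ Icc a b) :
    HasHDeriv a b (IccExtend hab.le f) t (derivOp hab.le t f) ∧
      derivOp hab.le t f ∈ convexElements X ∧ ι (derivOp hab.le t f) = Ψ t := by
  obtain ⟨z, hz, hzt⟩ := h.mem_image t
  have hd := h.hasHDeriv hiso hι hP hω hab.le ht hz hzt
  rw [derivOp, hd.hDeriv_eq hab]
  exact ⟨hd, hz, hzt⟩

theorem IsEmbeddedDeriv.divDiffOp_spec [LSpace X] [CompleteSpace E] (hiso : Isotropic X)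
    (hι : IsConvexEmbedding P ι) (hP : IsConvexifying P) {ω : ℝ → ℝ} (hω : IsModulus ω)
    {a b : ℝ} (hab : a ≤ b) {f : Icc a b → X} {Ψ : ℝ → E} (h : IsEmbeddedDeriv ι ω f Ψ)
    {t γ₁ γ₂ : ℝ} (hγ₁ : 0 ≤ γ₁) (hγ₂ : 0 ≤ γ₂) (ht₁ : t - γ₁ ∈ Icc a b) (ht₂ : t + γ₂ ∈ Icc a b) :
    divDiffOp hab γ₁ γ₂ t f ∈ convexElements X ∧
      ι (divDiffOp hab γ₁ γ₂ t f) = (γ₁ + γ₂)⁻¹ • ∫ s in (t - γ₁)..(t + γ₂), Ψ s := by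
  rw [divDiffOp, hDivDiff, IccExtend_of_mem hab f ht₁, IccExtend_of_mem hab f ht₂]
  have := h.hDiff_spec hiso hι hP hω (u := ⟨t - γ₁, ht₁⟩) (v := ⟨t + γ₂, ht₂⟩)
    (by rw [Subtype.mk_le_mk]; linarith)
  refine ⟨hP.smul_mem _ this.1, ?_⟩
  rw [hι.map_smul _ _ (by positivity), this.2.2]

end

/-! ### Differences of means in a normed space: the upper estimates -/

section
variable {E : Type*} [NormedAddCommGroup E] [NormedSpace ℝ E]

theorem Iω_eq_integral_abs {ω : ℝ → ℝ} {α : ℝ} (hα : 0 ≤ α) : Iω ω α = ∫ s in (0 : ℝ)..α, ω |s| := by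
  refine intervalIntegral.integral_congr fun s hs => ?_
  rw [uIcc_of_le hα] at hs
  simp only [abs_of_nonneg hs.1]

theorem integral_modulus_comp_mul {ω : ℝ → ℝ} {c d : ℝ} (hc : 0 < c) (hd : 0 ≤ d) :
    ∫ x in (0 : ℝ)..d, ω |c * x| = c⁻¹ * Iω ω (c * d) := by
  rw [Iω_eq_integral_abs (by positivity),
    intervalIntegral.integral_comp_mul_left (fun s => ω |s|) hc.ne', mul_zero, smul_eq_mul]

/-- A linear mass transport. Compared with the outer mean, the inner one has excess density on `[q₁,
q₂]`. That interval is cut in the ratio `d₁ : d₂`, and each part, reflected at its end point `q₁` or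
`q₂`, is mapped linearly onto the adjacent outer piece. The factor `(q₂ - q₁) / (d₁ + d₂)` is the
ratio of the lengths. -/
theorem average_sub_average {ψ : ℝ → E} (hψ : Continuous ψ) {q₁ q₂ d₁ d₂ : ℝ}
    (hq : q₁ < q₂) (hd : 0 < d₁ + d₂) :
    (q₂ - q₁)⁻¹ • (∫ s in q₁..q₂, ψ s) -
        ((q₂ - q₁) + (d₁ + d₂))⁻¹ • (∫ s in (q₁ - d₁)..(q₂ + d₂), ψ s) =
      ((q₂ - q₁) + (d₁ + d₂))⁻¹ •
        ((∫ x in (0 : ℝ)..d₁, (ψ (q₁ + (q₂ - q₁) / (d₁ + d₂) * x) - ψ (q₁ - x))) +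
          ∫ x in (0 : ℝ)..d₂, (ψ (q₂ - (q₂ - q₁) / (d₁ + d₂) * x) - ψ (q₂ + x))) := by
  have hi : ∀ u v, IntervalIntegrable ψ volume u v := fun u v => hψ.intervalIntegrable u v
  have hΓ : 0 < q₂ - q₁ := sub_pos.2 hq
  have hκ : (q₂ - q₁) / (d₁ + d₂) ≠ 0 := (div_pos hΓ hd).ne'
  -- The two parts of the inner interval meet at a common cut point.
  have hp : q₂ - (q₂ - q₁) / (d₁ + d₂) * d₂ = q₁ + (q₂ - q₁) / (d₁ + d₂) * d₁ := by
    field_simp; ring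
  rw [intervalIntegral.integral_sub (Continuous.intervalIntegrable (by fun_prop) _ _)
      (Continuous.intervalIntegrable (by fun_prop) _ _),
    intervalIntegral.integral_sub (Continuous.intervalIntegrable (by fun_prop) _ _)
      (Continuous.intervalIntegrable (by fun_prop) _ _),
    intervalIntegral.integral_comp_add_mul ψ hκ, intervalIntegral.integral_comp_sub_mul ψ hκ,
    intervalIntegral.integral_comp_sub_left, intervalIntegral.integral_comp_add_left, hp,
    mul_zero, sub_zero, sub_zero, add_zero, add_zero,
    ← intervalIntegral.integral_add_adjacent_intervals (hi (q₁ - d₁) q₁) (hi q₁ (q₂ + d₂)),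
    ← intervalIntegral.integral_add_adjacent_intervals (hi q₁ q₂) (hi q₂ (q₂ + d₂)),
    ← intervalIntegral.integral_add_adjacent_intervals
      (hi q₁ (q₁ + (q₂ - q₁) / (d₁ + d₂) * d₁)) (hi _ q₂)]
  have hc : (q₂ - q₁)⁻¹ = ((q₂ - q₁) + (d₁ + d₂))⁻¹ +
      ((q₂ - q₁) + (d₁ + d₂))⁻¹ * ((q₂ - q₁) / (d₁ + d₂))⁻¹ := by
    have : (q₂ - q₁) + (d₁ + d₂) ≠ 0 := by positivity
    field_simp
  rw [hc]
  module

/-- The same transport when the inner interval shrinks to `t`: all the mass starts from one point.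
-/
theorem sub_average [CompleteSpace E] {ψ : ℝ → E} (hψ : Continuous ψ) {t h₁ h₂ : ℝ}
    (hh : 0 < h₁ + h₂) :
    ψ t - (h₁ + h₂)⁻¹ • (∫ s in (t - h₁)..(t + h₂), ψ s) =
      (h₁ + h₂)⁻¹ • ((∫ x in (0 : ℝ)..h₁, (ψ t - ψ (t - x))) +
        ∫ x in (0 : ℝ)..h₂, (ψ t - ψ (t + x))) := by
  have hi : ∀ u v, IntervalIntegrable ψ volume u v := fun u v => hψ.intervalIntegrable u v
  rw [intervalIntegral.integral_sub (Continuous.intervalIntegrable (by fun_prop) _ _)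
      (Continuous.intervalIntegrable (by fun_prop) _ _),
    intervalIntegral.integral_sub (Continuous.intervalIntegrable (by fun_prop) _ _)
      (Continuous.intervalIntegrable (by fun_prop) _ _),
    intervalIntegral.integral_comp_sub_left, intervalIntegral.integral_comp_add_left,
    intervalIntegral.integral_const, intervalIntegral.integral_const,
    sub_zero, sub_zero, sub_zero, add_zero,
    ← intervalIntegral.integral_add_adjacent_intervals (hi (t - h₁) t) (hi t (t + h₂))]
  have h1 : ψ t = (h₁ + h₂)⁻¹ • ((h₁ + h₂) • ψ t) := by
    rw [smul_smul, inv_mul_cancel₀ hh.ne', one_smul]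
  conv_lhs => rw [h1]
  module

theorem norm_integral_sub_le {ω : ℝ → ℝ} (hω : IsModulus ω) {Ψ : ℝ → E}
    (hΨ : ∀ s t, ‖Ψ s - Ψ t‖ ≤ ω |s - t|) {c d : ℝ} (hc : 0 < c) (hd : 0 ≤ d) {x y : ℝ → ℝ}
    (hxy : ∀ s, |x s - y s| = |c * s|) :
    ‖∫ s in (0 : ℝ)..d, (Ψ (x s) - Ψ (y s))‖ ≤ c⁻¹ * Iω ω (c * d) := by
  rw [← integral_modulus_comp_mul hc hd]
  refine intervalIntegral.norm_integral_le_of_norm_le hd ?_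
    ((hω.continuous_abs.comp (continuous_const.mul continuous_id)).intervalIntegrable _ _)
  exact Eventually.of_forall fun s _ => by
    have := hΨ (x s) (y s)
    rwa [hxy s] at this

theorem norm_average_sub_average_le {ω : ℝ → ℝ} (hω : IsModulus ω) {Ψ : ℝ → E}
    (hΨ : ∀ s t, ‖Ψ s - Ψ t‖ ≤ ω |s - t|) {t γ₁ γ₂ h₁ h₂ : ℝ} (hγ : 0 < γ₁ + γ₂)
    (h1 : γ₁ ≤ h₁) (h2 : γ₂ ≤ h₂) :
    ‖(γ₁ + γ₂)⁻¹ • (∫ s in (t - γ₁)..(t + γ₂), Ψ s) -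
      (h₁ + h₂)⁻¹ • (∫ s in (t - h₁)..(t + h₂), Ψ s)‖ ≤ Kω ω γ₁ γ₂ h₁ h₂ := by
  have hcont : Continuous Ψ := hω.continuous_of_dist_le fun s t => by
    rw [dist_eq_norm]; exact hΨ s t
  -- If the two intervals coincide, the leading factor of `Kω` is zero, whatever its divisions by
  -- zero give.
  rcases (add_nonneg (sub_nonneg.2 h1) (sub_nonneg.2 h2)).eq_or_lt with hD | hD
  · obtain rfl : γ₁ = h₁ := by linarith
    obtain rfl : γ₂ = h₂ := by linarith
    simp [Kω]
  · have key := average_sub_average hcont (q₁ := t - γ₁) (q₂ := t + γ₂) (d₁ := h₁ - γ₁)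
      (d₂ := h₂ - γ₂) (by linarith) hD
    have e1 : t + γ₂ - (t - γ₁) = γ₁ + γ₂ := by ring
    have e2 : γ₁ + γ₂ + (h₁ - γ₁ + (h₂ - γ₂)) = h₁ + h₂ := by ring
    have e3 : t - γ₁ - (h₁ - γ₁) = t - h₁ := by ring
    have e4 : t + γ₂ + (h₂ - γ₂) = t + h₂ := by ring
    rw [e1, e2, e3, e4] at key
    have hH : 0 < h₁ + h₂ := by linarith
    have hc : 0 < (h₁ + h₂) / (h₁ - γ₁ + (h₂ - γ₂)) := by positivity
    -- Transported points are at distance `c * s`, with `c` the ratio of the outer length to the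
    -- added length.
    have e5 : ∀ s : ℝ, (h₁ + h₂) / (h₁ - γ₁ + (h₂ - γ₂)) * s =
        (γ₁ + γ₂) / (h₁ - γ₁ + (h₂ - γ₂)) * s + s := fun s => by field_simp; ring
    rw [key, norm_smul, Real.norm_of_nonneg (by positivity)]
    have b1 := norm_integral_sub_le hω hΨ hc (sub_nonneg.2 h1)
      (x := fun s => t - γ₁ + (γ₁ + γ₂) / (h₁ - γ₁ + (h₂ - γ₂)) * s)
      (y := fun s => t - γ₁ - s) (fun s => by rw [e5]; congr 1; ring)
    have b2 := norm_integral_sub_le hω hΨ hc (sub_nonneg.2 h2)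
      (x := fun s => t + γ₂ - (γ₁ + γ₂) / (h₁ - γ₁ + (h₂ - γ₂)) * s)
      (y := fun s => t + γ₂ + s) (fun s => by rw [e5, ← abs_neg]; congr 1; ring)
    calc _ ≤ (h₁ + h₂)⁻¹ * (_ + _) :=
          mul_le_mul_of_nonneg_left ((norm_add_le _ _).trans (add_le_add b1 b2)) (by positivity)
      _ = _ := by
          rw [Kω, div_mul_eq_mul_div, div_mul_eq_mul_div, inv_div]
          field_simp

theorem norm_sub_average_le [CompleteSpace E] {ω : ℝ → ℝ} (hω : IsModulus ω) {Ψ : ℝ → E}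
    (hΨ : ∀ s t, ‖Ψ s - Ψ t‖ ≤ ω |s - t|) {t h₁ h₂ : ℝ} (hh : 0 < h₁ + h₂)
    (h1 : 0 ≤ h₁) (h2 : 0 ≤ h₂) :
    ‖Ψ t - (h₁ + h₂)⁻¹ • (∫ s in (t - h₁)..(t + h₂), Ψ s)‖ ≤
      (Iω ω h₁ + Iω ω h₂) / (h₁ + h₂) := by
  have hcont : Continuous Ψ := hω.continuous_of_dist_le fun s t => by
    rw [dist_eq_norm]; exact hΨ s t
  rw [sub_average hcont hh, norm_smul, Real.norm_of_nonneg (by positivity), div_eq_inv_mul]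
  have b1 := norm_integral_sub_le hω hΨ one_pos h1 (x := fun _ => t) (y := fun s => t - s)
    (fun s => by congr 1; ring)
  have b2 := norm_integral_sub_le hω hΨ one_pos h2 (x := fun _ => t) (y := fun s => t + s)
    (fun s => by rw [← abs_neg]; congr 1; ring)
  rw [inv_one, one_mul, one_mul] at b1 b2
  exact mul_le_mul_of_nonneg_left ((norm_add_le _ _).trans (add_le_add b1 b2)) (by positivity)

end

/-! ### Admissibility of the divided difference and upper bounds for the deviations -/

section
variable {X : Type*} [MetricSpace X] [AddCommMonoid X] [DistribMulAction ℝ X] {P : X → X}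

theorem exists_hDiff_eq {a b : ℝ} {f : Icc a b → X} (hf : f ∈ CH X a b) {u v : Icc a b}
    (huv : u ≤ v) : ∃ z : X, f v = f u + z := by
  rcases huv.eq_or_lt with rfl | huv
  · exact ⟨0, (add_zero _).symm⟩
  · exact hf.2 u v huv

/-- If `f v = f u + z`, isotropy gives `‖z‖ = h(f v, f u) ≤ ‖f v‖ + ‖f u‖`, which explains the
constant 2. -/
theorem admissible_divDiffOp [LSpace X] (hiso : Isotropic X) {a b : ℝ} (hab : a ≤ b)
    {t h₁ h₂ : ℝ} (hh : 0 < h₁ + h₂) (ht₁ : t - h₁ ∈ Icc a b)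
    (ht₂ : t + h₂ ∈ Icc a b) :
    Admissible (2 / (h₁ + h₂)) (fun f : CH X a b => divDiffOp hab h₁ h₂ t f.1) := by
  have huv : (⟨t - h₁, ht₁⟩ : Icc a b) ≤ ⟨t + h₂, ht₂⟩ := by
    rw [Subtype.mk_le_mk]; linarith
  constructor
  · intro α f g _ hfg
    obtain ⟨z, hz⟩ := exists_hDiff_eq f.2 huv
    have hg : g.1 ⟨t + h₂, ht₂⟩ = g.1 ⟨t - h₁, ht₁⟩ + α • z := by
      rw [hfg, hfg, hz, smul_add]
    simp only [divDiffOp, hDivDiff, IccExtend_of_mem hab _ ht₁, IccExtend_of_mem hab _ ht₂]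
    rw [hiso.hDiff_eq hz, hiso.hDiff_eq hg, smul_comm]
  · refine iSup₂_le fun f hf => ?_
    obtain ⟨z, hz⟩ := exists_hDiff_eq f.2 huv
    simp only [divDiffOp, hDivDiff, IccExtend_of_mem hab _ ht₁, IccExtend_of_mem hab _ ht₂]
    have hle : ∀ u, dist (f.1 u) 0 ≤ 1 := fun u => by
      have : edist (f.1 u) 0 ≤ 1 := (le_iSup (fun u => edist (f.1 u) 0) u).trans hf
      rwa [edist_dist, ENNReal.ofReal_le_one] at this
    rw [hiso.hDiff_eq hz, edist_dist]
    refine ENNReal.ofReal_le_ofReal ?_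
    have h0 : dist ((h₁ + h₂)⁻¹ • z) 0 = (h₁ + h₂)⁻¹ * dist z 0 := by
      conv_lhs => rw [← smul_zero (A := X) (h₁ + h₂)⁻¹]
      rw [LSpace.dist_smul, abs_of_pos (by positivity)]
    rw [h0, ← hiso.dist_add_self (f.1 ⟨t - h₁, ht₁⟩) z, ← hz, div_eq_inv_mul]
    refine mul_le_mul_of_nonneg_left ?_ (by positivity)
    have := dist_triangle_right (f.1 ⟨t + h₂, ht₂⟩) (f.1 ⟨t - h₁, ht₁⟩) 0
    linarith [hle ⟨t + h₂, ht₂⟩, hle ⟨t - h₁, ht₁⟩]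

variable {E : Type*} [NormedAddCommGroup E] [NormedSpace ℝ E] {ι : X → E}

theorem deviation_divDiffOp_le [LSpace X] [CompleteSpace E] (hiso : Isotropic X)
    (hι : IsConvexEmbedding P ι) (hP : IsConvexifying P) {ω : ℝ → ℝ} (hω : IsModulus ω)
    {a b : ℝ} (hab : a ≤ b) {t γ₁ γ₂ h₁ h₂ : ℝ} (hγ : 0 < γ₁ + γ₂) (hγ₁ : 0 ≤ γ₁)
    (hγ₂ : 0 ≤ γ₂) (h1 : γ₁ ≤ h₁) (h2 : γ₂ ≤ h₂) (hs₁ : t - γ₁ ∈ Icc a b)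
    (hs₂ : t + γ₂ ∈ Icc a b) (ht₁ : t - h₁ ∈ Icc a b) (ht₂ : t + h₂ ∈ Icc a b) :
    deviation P ω (divDiffOp hab γ₁ γ₂ t)
        (fun f : CH X a b => divDiffOp hab h₁ h₂ t f.1) ≤
      ENNReal.ofReal (Kω ω γ₁ γ₂ h₁ h₂) := by
  refine iSup₂_le fun f hf => ?_
  obtain ⟨Ψ, hΨ⟩ := exists_isEmbeddedDeriv hι hP hω hab hf
  rw [edist_dist]
  refine ENNReal.ofReal_le_ofReal ?_
  obtain ⟨m1, e1⟩ := hΨ.divDiffOp_spec hiso hι hP hω hab hγ₁ hγ₂ hs₁ hs₂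
  obtain ⟨m2, e2⟩ := hΨ.divDiffOp_spec hiso hι hP hω hab (hγ₁.trans h1) (hγ₂.trans h2) ht₁ ht₂
  rw [← hι.dist_eq_of_mem hP m1 m2, e1, e2, dist_eq_norm]
  exact norm_average_sub_average_le hω hΨ.norm_sub_le hγ h1 h2

theorem deviation_derivOp_le [LSpace X] [CompleteSpace E] (hiso : Isotropic X)
    (hι : IsConvexEmbedding P ι) (hP : IsConvexifying P) {ω : ℝ → ℝ} (hω : IsModulus ω)
    {a b : ℝ} (hab : a < b) {t h₁ h₂ : ℝ} (ht : t ∈ Icc a b) (hh : 0 < h₁ + h₂) (h1 : 0 ≤ h₁)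
    (h2 : 0 ≤ h₂) (ht₁ : t - h₁ ∈ Icc a b) (ht₂ : t + h₂ ∈ Icc a b) :
    deviation P ω (derivOp hab.le t)
        (fun f : CH X a b => divDiffOp hab.le h₁ h₂ t f.1) ≤
      ENNReal.ofReal ((Iω ω h₁ + Iω ω h₂) / (h₁ + h₂)) := by
  refine iSup₂_le fun f hf => ?_
  obtain ⟨Ψ, hΨ⟩ := exists_isEmbeddedDeriv hι hP hω hab.le hf
  rw [edist_dist]
  refine ENNReal.ofReal_le_ofReal ?_
  obtain ⟨-, m1, e1⟩ := hΨ.derivOp_spec hiso hι hP hω hab ht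
  obtain ⟨m2, e2⟩ := hΨ.divDiffOp_spec hiso hι hP hω hab.le h1 h2 ht₁ ht₂
  rw [← hι.dist_eq_of_mem hP m1 m2, e1, e2, dist_eq_norm]
  exact norm_sub_average_le hω hΨ.norm_sub_le hh h1 h2

end

/-! ### An isometric real line in the cone and the general lower bound -/

section
variable {X : Type*} [MetricSpace X] [AddCommMonoid X] [DistribMulAction ℝ X] {P : X → X}

/-- An isometric additive map of the real line to the convex elements. -/
structure IsConvexLine (J : ℝ → X) : Prop where
  map_add : ∀ r s, J (r + s) = J r + J s
  dist_eq : ∀ r s, dist (J r) (J s) = |r - s|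
  mem : ∀ r, J r ∈ convexElements X
  smul_eq : ∀ α r : ℝ, 0 ≤ α → α • J r = J (α * r)

theorem dist_smul_zero [LSpace X] (α : ℝ) (x : X) : dist (α • x) 0 = |α| * dist x 0 := by
  conv_lhs => rw [← smul_zero (A := X) α]
  exact LSpace.dist_smul α x 0

theorem Isotropic.mem_convexElements_of_add_eq_zero (hiso : Isotropic X) {x x' : X}
    (hx : x ∈ convexElements X) (h : x + x' = 0) : x' ∈ convexElements X := by
  intro α β hα hβ
  refine hiso.add_left_cancel (z := (α + β) • x) ?_
  rw [← smul_add, h, smul_zero, hx α β hα hβ, add_add_add_comm, ← smul_add, ← smul_add, h,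
    smul_zero, smul_zero, add_zero]

/-- For a nonzero invertible convex `x` with inverse `x'`, the line runs along `x` for positive and
along `x'` for negative parameters. The inverse is convex too, and isotropy gives it the same norm
`n`, so division by `n` makes both rays isometric. -/
theorem exists_isConvexLine [LSpace X] (hiso : Isotropic X) (hP : IsConvexifying P)
    (hX : invertibleElements X ∩ convexElements X ≠ {0}) : ∃ J : ℝ → X, IsConvexLine J := by
  obtain ⟨x, ⟨⟨x', hxx'⟩, hx⟩, hx0⟩ :
      ∃ x, x ∈ invertibleElements X ∩ convexElements X ∧ x ≠ 0 := by
    by_contra! hall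
    exact hX (Subset.antisymm hall (singleton_subset_iff.2 ⟨⟨0, add_zero 0⟩, hP.zero_mem⟩))
  have hx' := hiso.mem_convexElements_of_add_eq_zero hx hxx'
  set n := dist x 0 with hn
  have hn0 : 0 < n := dist_pos.2 hx0
  have hn' : dist x' 0 = n := by
    rw [← hiso.dist_add_self x x', hxx', dist_comm]
  -- A combination `u • x + v • x'` depends on `u - v` only; this gives additivity across the sign
  -- change.
  have hG : ∀ u v u' v' : ℝ, 0 ≤ u → 0 ≤ v → 0 ≤ u' → 0 ≤ v' → u + v' = u' + v →
      u • x + v • x' = u' • x + v' • x' := by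
    intro u v u' v' hu hv hu' hv' h
    have e5 : u • x + v' • x = u' • x + v • x := by
      rw [← hx u v' hu hv', ← hx u' v hu' hv, h]
    refine hiso.add_left_cancel (z := v • x + v' • x) ?_
    calc v • x + v' • x + (u • x + v • x') = (u • x + v' • x) + v • (x + x') := by
          rw [smul_add]; abel
      _ = (u' • x + v • x) + v' • (x + x') := by
          rw [hxx', smul_zero, smul_zero, e5]
      _ = v • x + v' • x + (u' • x + v' • x') := by rw [smul_add]; abel
  set J : ℝ → X := fun r => (max r 0 / n) • x + (max (-r) 0 / n) • x' with hJ
  have hmax : ∀ r : ℝ, max r 0 - max (-r) 0 = r := fun r => by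
    rcases le_total r 0 with h | h
    · rw [max_eq_right h, max_eq_left (by linarith)]; ring
    · rw [max_eq_left h, max_eq_right (by linarith)]; ring
  have hadd : ∀ r s, J (r + s) = J r + J s := by
    intro r s
    have : J r + J s =
        (max r 0 / n + max s 0 / n) • x + (max (-r) 0 / n + max (-s) 0 / n) • x' := by
      rw [hx _ _ (by positivity) (by positivity), hx' _ _ (by positivity) (by positivity)]
      simp only [hJ]; abel
    rw [this]
    refine hG _ _ _ _ (by positivity) (by positivity) (by positivity) (by positivity) ?_
    rw [← add_div, ← add_div, ← add_div, ← add_div]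
    congr 1
    linarith [hmax r, hmax s, hmax (r + s)]
  have hnorm : ∀ r, dist (J r) 0 = |r| := by
    intro r
    rcases le_total r 0 with h | h
    · simp only [hJ]
      rw [max_eq_right h, max_eq_left (by linarith), zero_div, LSpace.zero_smul, zero_add,
        dist_smul_zero, hn', abs_div, abs_neg, abs_of_pos hn0, div_mul_cancel₀ _ hn0.ne']
    · simp only [hJ]
      rw [max_eq_left h, max_eq_right (by linarith), zero_div, LSpace.zero_smul, add_zero,
        dist_smul_zero, ← hn, abs_div, abs_of_pos hn0, div_mul_cancel₀ _ hn0.ne']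
  refine ⟨J, hadd, fun r s => ?_, fun r => hP.add_mem (hP.smul_mem _ hx) (hP.smul_mem _ hx'),
    fun α r hα => ?_⟩
  · rw [← hnorm, ← hiso.dist_add_self (J s) (J (r - s)), ← hadd, add_sub_cancel]
  · simp only [hJ]
    rw [smul_add, smul_smul, smul_smul, mul_div_assoc', mul_div_assoc', mul_max_of_nonneg _ _ hα,
      mul_max_of_nonneg _ _ hα, mul_zero, mul_neg]

theorem IsConvexLine.map_zero (hiso : Isotropic X) {J : ℝ → X} (hJ : IsConvexLine J) :
    J 0 = 0 := by
  refine hiso.add_left_cancel (z := J 0) ?_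
  rw [← hJ.map_add, add_zero, add_zero]

theorem IsConvexLine.dist_zero (hiso : Isotropic X) {J : ℝ → X} (hJ : IsConvexLine J) (r : ℝ) :
    dist (J r) 0 = |r| := by
  rw [← hJ.map_zero hiso, hJ.dist_eq, sub_zero]

variable {E : Type*} [NormedAddCommGroup E] [NormedSpace ℝ E] {ι : X → E}

theorem IsConvexLine.embed [LSpace X] (hiso : Isotropic X) (hι : IsConvexEmbedding P ι)
    {J : ℝ → X} (hJ : IsConvexLine J) (r : ℝ) : ι (J r) = r • ι (J 1) := by
  have hpos : ∀ r : ℝ, 0 ≤ r → ι (J r) = r • ι (J 1) := fun r hr => by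
    rw [← hι.map_smul _ _ hr, hJ.smul_eq _ _ hr, mul_one]
  rcases le_total 0 r with hr | hr
  · exact hpos r hr
  · have h := hι.map_add (J r) (J (-r))
    rw [← hJ.map_add, add_neg_cancel, hJ.map_zero hiso, hι.map_zero,
      hpos _ (neg_nonneg.2 hr), neg_smul, ← sub_eq_add_neg] at h
    exact sub_eq_zero.1 h.symm

theorem IsConvexLine.norm_embed [LSpace X] (hiso : Isotropic X) (hι : IsConvexEmbedding P ι)
    (hP : IsConvexifying P) {J : ℝ → X} (hJ : IsConvexLine J) : ‖ι (J 1)‖ = 1 := by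
  rw [← dist_zero_right, ← hι.map_zero, hι.dist_eq_of_mem hP (hJ.mem 1) hP.zero_mem,
    hJ.dist_zero hiso, abs_one]

/-- The step function that takes on `[k/n, (k+1)/n) ∩ [a, b]` the value `g k`. -/
noncomputable def stepFunc {a b : ℝ} (hab : a ≤ b) (n : ℕ) (g : ℤ → X) : SimpleFunc ℝ X where
  toFun s := g ⌊(n : ℝ) * projIcc a b hab s⌋
  measurableSet_fiber' x := by
    have hm : Measurable fun s : ℝ => ⌊(n : ℝ) * projIcc a b hab s⌋ :=
      Int.measurable_floor.comp
        (measurable_const.mul (continuous_subtype_val.comp continuous_projIcc).measurable)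
    exact hm (MeasurableSpace.measurableSet_top (s := g ⁻¹' {x}))
  finite_range' := by
    refine ((finite_Icc ⌊(n : ℝ) * a⌋ ⌊(n : ℝ) * b⌋).image g).subset ?_
    rintro _ ⟨s, rfl⟩
    have := (projIcc a b hab s).2
    refine ⟨_, ⟨Int.floor_mono ?_, Int.floor_mono ?_⟩, rfl⟩
    · exact mul_le_mul_of_nonneg_left this.1 n.cast_nonneg
    · exact mul_le_mul_of_nonneg_left this.2 n.cast_nonneg

/-- Membership in the class requires actual simple functions. Samples of `ψ` on a grid of mesh `1 /
(n + 1)` converge uniformly, and their integrals converge because this can be tested in `E`. -/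
theorem IsConvexLine.hasLIntegral [LSpace X] [CompleteSpace E] (hiso : Isotropic X)
    (hι : IsConvexEmbedding P ι) (hP : IsConvexifying P) {J : ℝ → X} (hJ : IsConvexLine J)
    {ω : ℝ → ℝ} (hω : IsModulus ω) {ψ : ℝ → ℝ} (hψ : ∀ s t, |ψ s - ψ t| ≤ ω |s - t|) {u v : ℝ}
    (huv : u ≤ v) : HasLIntegral P (fun s => J (ψ s)) u v (J (∫ s in u..v, ψ s)) := by
  have hcont : Continuous ψ := hω.continuous_of_dist_le hψ
  have hunif : TendstoUniformlyOn
      (fun (n : ℕ) s => stepFunc huv (n + 1) (fun k => J (ψ (k / ((n + 1 : ℕ) : ℝ)))) s)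
      (fun s => J (ψ s)) atTop (Icc u v) := by
    have h0 : Tendsto (fun n : ℕ => ω |1 / ((n : ℝ) + 1)|) atTop (𝓝 0) := by
      have := (hω.continuous_abs.tendsto 0).comp (tendsto_one_div_add_atTop_nhds_zero_nat (𝕜 := ℝ))
      simpa only [abs_zero, hω.zero, Function.comp_def] using this
    rw [Metric.tendstoUniformlyOn_iff]
    intro ε hε
    filter_upwards [h0.eventually_lt_const hε] with n hn s hs
    refine lt_of_le_of_lt ?_ hn
    change dist (J (ψ s)) (J (ψ ((⌊((n + 1 : ℕ) : ℝ) * projIcc u v huv s⌋ : ℝ) /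
      ((n + 1 : ℕ) : ℝ)))) ≤ _
    rw [hJ.dist_eq, projIcc_of_mem huv hs]
    refine (hψ _ _).trans (hω.mono (mem_Ici.2 (abs_nonneg _)) (mem_Ici.2 (abs_nonneg _)) ?_)
    have hn1 : (0 : ℝ) < ((n + 1 : ℕ) : ℝ) := by positivity
    have e1 := Int.floor_le (((n + 1 : ℕ) : ℝ) * s)
    have e2 := Int.lt_floor_add_one (((n + 1 : ℕ) : ℝ) * s)
    have e3 : s - (⌊((n + 1 : ℕ) : ℝ) * s⌋ : ℝ) / ((n + 1 : ℕ) : ℝ) =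
        (((n + 1 : ℕ) : ℝ) * s - ⌊((n + 1 : ℕ) : ℝ) * s⌋) / ((n + 1 : ℕ) : ℝ) := by
      field_simp
    simp only [e3]
    rw [abs_div, abs_div, abs_one, abs_of_nonneg (sub_nonneg.2 e1), abs_of_pos hn1,
      abs_of_pos (show (0 : ℝ) < n + 1 by positivity), Nat.cast_add_one]
    refine div_le_div_of_nonneg_right ?_ (by positivity)
    push_cast at e2 ⊢
    linarith
  refine ⟨_, hunif, ?_⟩
  have heq : (fun s => ι (J (ψ s))) = fun s => ψ s • ι (J 1) :=
    funext fun s => hJ.embed hiso hι _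
  have hc : Continuous fun s => ι (J (ψ s)) := by
    rw [heq]
    exact hcont.smul continuous_const
  have h1 := hι.tendsto_simpleIntegral hP hc.continuousOn hunif
  rw [tendsto_iff_dist_tendsto_zero] at h1 ⊢
  refine h1.congr fun n => ?_
  rw [← hι.dist_eq_of_mem hP (hP.simpleIntegral_mem _ _ _) (hJ.mem _)]
  congr 1
  rw [hJ.embed hiso hι, integral_Icc_eq_integral_Ioc, ← intervalIntegral.integral_of_le huv,
    heq]
  exact intervalIntegral.integral_smul_const _ _

theorem IsConvexLine.mem_W1Hω [LSpace X] [CompleteSpace E] (hiso : Isotropic X)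
    (hι : IsConvexEmbedding P ι) (hP : IsConvexifying P) {J : ℝ → X} (hJ : IsConvexLine J)
    {ω : ℝ → ℝ} (hω : IsModulus ω) {ψ : ℝ → ℝ} (hψ : ∀ s t, |ψ s - ψ t| ≤ ω |s - t|)
    (a b c : ℝ) : (fun u : Icc a b => J (c + ∫ s in a..u.1, ψ s)) ∈ W1Hω P ω a b :=
  ⟨fun s => J (ψ s), fun s _ t _ => (hJ.dist_eq _ _).trans_le (hψ s t), J c, hJ.mem c,
    fun u => ⟨_, hJ.hasLIntegral hiso hι hP hω hψ u.2.1, hJ.map_add _ _⟩⟩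

theorem IsConvexLine.isEmbeddedDeriv [LSpace X] [CompleteSpace E] (hiso : Isotropic X)
    (hι : IsConvexEmbedding P ι) (hP : IsConvexifying P) {J : ℝ → X} (hJ : IsConvexLine J)
    {ω : ℝ → ℝ} (hω : IsModulus ω) {ψ : ℝ → ℝ} (hψ : ∀ s t, |ψ s - ψ t| ≤ ω |s - t|)
    (a b c : ℝ) :
    IsEmbeddedDeriv ι ω (fun u : Icc a b => J (c + ∫ s in a..u.1, ψ s))
      (fun s => ψ s • ι (J 1)) where
  norm_sub_le s t := by
    rw [← sub_smul, norm_smul, hJ.norm_embed hiso hι hP, mul_one]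
    exact hψ s t
  mem_image s := ⟨J (ψ s), hJ.mem _, hJ.embed hiso hι _⟩
  mem_convexElements u := hJ.mem _
  sub_eq u v := by
    have hcont : Continuous ψ := hω.continuous_of_dist_le hψ
    rw [hJ.embed hiso hι, hJ.embed hiso hι (c + ∫ s in a..u.1, ψ s), ← sub_smul,
      add_sub_add_left_eq_sub, intervalIntegral.integral_interval_sub_left
        (hcont.intervalIntegrable _ _) (hcont.intervalIntegrable _ _),
      intervalIntegral.integral_smul_const]

theorem smul_mem_CH [LSpace X] {a b : ℝ} {f : Icc a b → X} (hf : f ∈ CH X a b) (α : ℝ) :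
    (fun u => α • f u) ∈ CH X a b := by
  refine ⟨?_, fun u v huv => ?_⟩
  · have : LipschitzWith ⟨|α|, abs_nonneg α⟩ fun x : X => α • x :=
      LipschitzWith.of_dist_le_mul fun x y => (LSpace.dist_smul α x y).le
    exact this.continuous.comp hf.1
  · obtain ⟨z, hz⟩ := hf.2 u v huv
    exact ⟨α • z, by simp only [hz, smul_add]⟩

theorem Admissible.dist_le [LSpace X] {a b N : ℝ} {T : CH X a b → X} (hN : 0 ≤ N)
    (hT : Admissible N T) (f : CH X a b) {M : ℝ} (hM : 0 ≤ M) (hf : ∀ u, dist (f.1 u) 0 ≤ M) :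
    dist (T f) 0 ≤ N * M := by
  -- `M` may be zero, so `f` is rescaled by `M' > M`, and `M'` then tends to `M`.
  have key : ∀ M' : ℝ, M < M' → dist (T f) 0 ≤ N * M' := fun M' hM' => by
    have hM0 : 0 < M' := hM.trans_lt hM'
    let g : CH X a b := ⟨fun u => M'⁻¹ • f.1 u, smul_mem_CH f.2 _⟩
    have hTf : T f = M' • T g := hT.1 M' g f hM0 fun u => by
      rw [smul_smul, mul_inv_cancel₀ hM0.ne', one_smul]
    have hg : supNorm g.1 ≤ 1 := iSup_le fun u => by
      rw [edist_dist, ENNReal.ofReal_le_one]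
      change dist (M'⁻¹ • f.1 u) 0 ≤ 1
      rw [dist_smul_zero, abs_of_pos (inv_pos.2 hM0), inv_mul_le_one₀ hM0]
      exact (hf u).trans hM'.le
    have hTg : edist (T g) 0 ≤ ENNReal.ofReal N :=
      (le_iSup₂ (f := fun (f : CH X a b) (_ : supNorm f.1 ≤ 1) => edist (T f) 0) g hg).trans hT.2
    rw [edist_dist, ENNReal.ofReal_le_ofReal_iff hN] at hTg
    rw [hTf, dist_smul_zero, abs_of_pos hM0, mul_comm]
    exact mul_le_mul_of_nonneg_right hTg hM0.le
  have hlim : Tendsto (fun M' => N * M') (𝓝[>] M) (𝓝 (N * M)) :=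
    ((continuous_const.mul continuous_id).tendsto M).mono_left nhdsWithin_le_nhds
  exact ge_of_tendsto hlim (eventually_mem_nhdsWithin.mono key)

/-- On `[a, b]` the primitive is constant before `u` and after `v`, and increases by the full
integral in between. Centring its range halves the sup norm. -/
theorem abs_integral_sub_half_le {ψ : ℝ → ℝ} (hψ : Continuous ψ) {a b u v s : ℝ}
    (hs : s ∈ Icc a b) (hu : u ∈ Icc a b) (hv : v ∈ Icc a b) (huv : u ≤ v)
    (h0 : ∀ s ∈ Icc a b, 0 ≤ ψ s)
    (h1 : ∀ s ∈ Icc a b, s < u ∨ v < s → ψ s = 0) :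
    |(∫ x in u..s, ψ x) - (∫ x in u..v, ψ x) / 2| ≤ (∫ x in u..v, ψ x) / 2 := by
  have hi : ∀ u v, IntervalIntegrable ψ volume u v := fun u v => hψ.intervalIntegrable u v
  have hz : ∀ p q, p ≤ q → p ∈ Icc a b → q ∈ Icc a b → (q ≤ u ∨ v ≤ p) → ∫ x in p..q, ψ x = 0 := by
    intro p q hpq hp hq h
    rw [intervalIntegral.integral_of_le hpq, integral_Ioc_eq_integral_Ioo]
    refine setIntegral_eq_zero_of_forall_eq_zero fun x hx => h1 x
      ⟨hp.1.trans hx.1.le, hx.2.le.trans hq.2⟩ ?_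
    rcases h with h | h
    · exact Or.inl (hx.2.trans_le h)
    · exact Or.inr (h.trans_lt hx.1)
  have hnn : ∀ p q, p ≤ q → p ∈ Icc a b → q ∈ Icc a b → 0 ≤ ∫ x in p..q, ψ x :=
    fun p q hpq hp hq => intervalIntegral.integral_nonneg hpq fun x hx =>
      h0 x ⟨hp.1.trans hx.1, hx.2.trans hq.2⟩
  have hadd := intervalIntegral.integral_add_adjacent_intervals (hi u s) (hi s v)
  have huv0 := hnn u v huv hu hv
  rw [abs_le]
  rcases lt_or_ge s u with hsu | hsu
  · have := hz s u hsu.le hs hu (Or.inl le_rfl)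
    rw [intervalIntegral.integral_symm s u, this]
    constructor <;> linarith
  · rcases lt_or_ge v s with hvs | hvs
    · have := hz v s hvs.le hv hs (Or.inr le_rfl)
      rw [intervalIntegral.integral_symm v s, this] at hadd
      constructor <;> linarith
    · have e1 := hnn u s hsu hu hs
      have e2 := hnn s v hvs hs hv
      constructor <;> linarith

/-- The test function `J (c + ∫ ψ)` has norm at most `m / 2`, so homogeneity and the norm bound
force `‖T f‖ ≤ m / (h₁ + h₂)` for every competitor, whereas `‖A f‖ ≥ r`. The triangle inequality
does the rest. -/
theorem le_bestApprox [LSpace X] [CompleteSpace E] (hiso : Isotropic X)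
    (hι : IsConvexEmbedding P ι) (hP : IsConvexifying P) {J : ℝ → X} (hJ : IsConvexLine J)
    {ω : ℝ → ℝ} (hω : IsModulus ω) {ψ : ℝ → ℝ} (hψ : ∀ s t, |ψ s - ψ t| ≤ ω |s - t|)
    {a b t h₁ h₂ : ℝ} (hh : 0 < h₁ + h₂) (ht₁ : t - h₁ ∈ Icc a b) (ht₂ : t + h₂ ∈ Icc a b)
    (h0 : ∀ s ∈ Icc a b, 0 ≤ ψ s)
    (h1 : ∀ s ∈ Icc a b, s < t - h₁ ∨ t + h₂ < s → ψ s = 0) {A : (Icc a b → X) → X} {r : ℝ}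
    (hA : ∀ f, IsEmbeddedDeriv ι ω f (fun s => ψ s • ι (J 1)) → ι (A f) = r • ι (J 1)) :
    ENNReal.ofReal (r - (h₁ + h₂)⁻¹ * ∫ s in (t - h₁)..(t + h₂), ψ s) ≤
      bestApprox P ω A (2 / (h₁ + h₂)) := by
  have hcont : Continuous ψ := hω.continuous_of_dist_le hψ
  set m := ∫ s in (t - h₁)..(t + h₂), ψ s with hm
  -- With this constant the primitive equals `-m / 2` at `t - h₁` and `m / 2` at `t + h₂`.
  set c := -(∫ s in a..(t - h₁), ψ s) - m / 2 with hc
  refine le_iInf₂ fun T hT => ?_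
  have hd := hJ.isEmbeddedDeriv hiso hι hP hω hψ a b c
  let f : CH X a b := ⟨_, hd.mem_CH hiso hι hP hω⟩
  have hfW : f.1 ∈ W1Hω P ω a b := hJ.mem_W1Hω hiso hι hP hω hψ a b c
  refine le_trans ?_ (le_iSup₂ (f := fun (f : CH X a b) (_ : f.1 ∈ W1Hω P ω a b) =>
    edist (A f.1) (T f)) f hfW)
  rw [edist_dist]
  refine ENNReal.ofReal_le_ofReal ?_
  have hb : ∀ u, dist (f.1 u) 0 ≤ m / 2 := fun u => by
    have := abs_integral_sub_half_le hcont u.2 ht₁ ht₂ (by linarith) h0 h1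
    change dist (J (c + ∫ s in a..u.1, ψ s)) 0 ≤ m / 2
    rw [hJ.dist_zero hiso]
    convert this using 2
    rw [← intervalIntegral.integral_interval_sub_left
      (hcont.intervalIntegrable a u) (hcont.intervalIntegrable a (t - h₁))]
    ring
  have hm0 : 0 ≤ m / 2 := dist_nonneg.trans (hb ⟨_, ht₁⟩)
  have hTf := hT.dist_le (by positivity) f hm0 hb
  have hAf : r ≤ dist (A f.1) 0 := by
    refine le_trans ?_ (hι.dist_le hP _ _)
    rw [hι.map_zero, dist_zero_right, hA f.1 hd, norm_smul, hJ.norm_embed hiso hι hP, mul_one]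
    exact le_abs_self r
  have htri := dist_triangle (A f.1) (T f) 0
  have : 2 / (h₁ + h₂) * (m / 2) = (h₁ + h₂)⁻¹ * m := by field_simp
  linarith

end

/-! ### Extremal functions -/

section
variable {ω : ℝ → ℝ}

theorem IsModulus.abs_sub_le (hω : IsModulus ω) (s t : ℝ) :
    |ω (|s|) - ω (|t|)| ≤ ω |s - t| := by
  have key : ∀ s t : ℝ, ω |s| ≤ ω |t| + ω |s - t| := fun s t => by
    refine le_trans (hω.mono (mem_Ici.2 (abs_nonneg _)) (mem_Ici.2 (by positivity)) ?_)
      (hω.subadd _ _ (abs_nonneg _) (abs_nonneg _))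
    calc |s| = |t + (s - t)| := by ring_nf
      _ ≤ _ := abs_add_le _ _
  rw [abs_le]
  have h1 := key s t
  have h2 := key t s
  rw [abs_sub_comm t s] at h2
  constructor <;> linarith

/-- The extremal function for the approximation of the derivative. -/
noncomputable def derivExtremal (ω : ℝ → ℝ) (h t s : ℝ) : ℝ := max 0 (ω h - ω |s - t|)

theorem abs_derivExtremal_sub_le (hω : IsModulus ω) (h t s s' : ℝ) :
    |derivExtremal ω h t s - derivExtremal ω h t s'| ≤ ω |s - s'| := by
  refine (abs_max_sub_max_le_max _ _ _ _).trans ?_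
  rw [sub_self, abs_zero, max_eq_right (abs_nonneg _), sub_sub_sub_cancel_left, abs_sub_comm]
  simpa using hω.abs_sub_le (s - t) (s' - t)

theorem derivExtremal_eq_zero (hω : IsModulus ω) {h t s : ℝ} (hh : 0 ≤ h) (hs : h ≤ |s - t|) :
    derivExtremal ω h t s = 0 :=
  max_eq_left (sub_nonpos.2 (hω.mono (mem_Ici.2 hh) (mem_Ici.2 (hh.trans hs)) hs))

theorem derivExtremal_eq (hω : IsModulus ω) {h t s : ℝ} (hs : |s - t| ≤ h) :
    derivExtremal ω h t s = ω h - ω |s - t| :=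
  max_eq_right (sub_nonneg.2 (hω.mono (mem_Ici.2 (abs_nonneg _))
    (mem_Ici.2 ((abs_nonneg _).trans hs)) hs))

/-- Within distance `h` of `t` the function falls below its value at `t` by exactly `ω |x - t|`, so
every integrand in `sub_average` attains its bound. -/
theorem derivExtremal_sub_average (hω : IsModulus ω) {h t h₁ h₂ : ℝ} (hh : 0 < h₁ + h₂)
    (hp₁ : 0 ≤ h₁) (hp₂ : 0 ≤ h₂) (h1 : h₁ ≤ h) (h2 : h₂ ≤ h) :
    derivExtremal ω h t t -
        (h₁ + h₂)⁻¹ * ∫ s in (t - h₁)..(t + h₂), derivExtremal ω h t s =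
      (Iω ω h₁ + Iω ω h₂) / (h₁ + h₂) := by
  have hcont : Continuous (derivExtremal ω h t) :=
    hω.continuous_of_dist_le (abs_derivExtremal_sub_le hω h t)
  rw [← smul_eq_mul, sub_average hcont hh, smul_eq_mul, div_eq_inv_mul,
    Iω_eq_integral_abs hp₁, Iω_eq_integral_abs hp₂]
  have key : ∀ x, |x - t| ≤ h →
      derivExtremal ω h t t - derivExtremal ω h t x = ω |x - t| := fun x hx => by
    rw [derivExtremal_eq hω hx, derivExtremal_eq hω (by simpa using (abs_nonneg _).trans hx)]
    simp [hω.zero]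
  congr 2
  · refine intervalIntegral.integral_congr fun x hx => ?_
    rw [uIcc_of_le hp₁] at hx
    have e : |t - x - t| = |x| := by rw [← abs_neg]; congr 1; ring
    rw [key _ (by rw [e, abs_of_nonneg hx.1]; exact hx.2.trans h1), e]
  · refine intervalIntegral.integral_congr fun x hx => ?_
    rw [uIcc_of_le hp₂] at hx
    have e : |t + x - t| = |x| := by congr 1; ring
    rw [key _ (by rw [e, abs_of_nonneg hx.1]; exact hx.2.trans h2), e]

/-- The decrease, at distance `y` from the point of maximum, of one branch of the extremal function
for the approximation of divided differences. -/
noncomputable def branch (ω : ℝ → ℝ) (l A y : ℝ) : ℝ :=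
  l * ω A - l * ω (max 0 (A - y / l)) + (1 - l) * ω (max 0 ((y - l * A) / (1 - l)))

/-- Together with `branch_outer` this explains the form of `branch`: the points `l * A - l * z` and
`l * A + (1 - l) * z` are `z` apart, and the values there differ by exactly `ω z`. -/
theorem branch_inner {l A z : ℝ} (hω : IsModulus ω) (hl : 0 < l) (hl1 : l < 1) (hz : 0 ≤ z) :
    branch ω l A (l * A - l * z) = l * ω A - l * ω z := by
  have e1 : A - (l * A - l * z) / l = z := by field_simp; ring
  have e2 : (l * A - l * z - l * A) / (1 - l) ≤ 0 :=
    div_nonpos_of_nonpos_of_nonneg (by nlinarith) (by linarith)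
  rw [branch, e1, max_eq_right hz, max_eq_left e2, hω.zero, mul_zero, add_zero]

theorem branch_outer {l A z : ℝ} (hω : IsModulus ω) (hl : 0 < l) (hl1 : l < 1) (hz : 0 ≤ z) :
    branch ω l A (l * A + (1 - l) * z) = l * ω A + (1 - l) * ω z := by
  have hl' : 0 < 1 - l := sub_pos.2 hl1
  have e1 : A - (l * A + (1 - l) * z) / l ≤ 0 := by
    rw [sub_nonpos, le_div_iff₀ hl]; nlinarith
  have e2 : (l * A + (1 - l) * z - l * A) / (1 - l) = z := by field_simp; ring
  rw [branch, e2, max_eq_right hz, max_eq_left e1, hω.zero, mul_zero, sub_zero]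

theorem branch_zero {l A : ℝ} (hω : IsModulus ω) (hl : 0 < l) (hl1 : l < 1) (hA : 0 ≤ A) :
    branch ω l A 0 = 0 := by
  have := branch_inner (A := A) hω hl hl1 hA
  rwa [sub_self, sub_self] at this

theorem branch_self {l A : ℝ} (hω : IsModulus ω) (hl : 0 < l) (hl1 : l < 1) (hA : 0 ≤ A) :
    branch ω l A A = ω A := by
  have := branch_outer (A := A) hω hl hl1 hA
  rw [show l * A + (1 - l) * A = A by ring] at this
  rw [this]; ring

theorem branch_mono {l A : ℝ} (hω : IsModulus ω) (hl : 0 < l) (hl1 : l < 1) :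
    Monotone (branch ω l A) := by
  intro y y' h
  have hl' : 0 < 1 - l := sub_pos.2 hl1
  have m1 : ω (max 0 (A - y' / l)) ≤ ω (max 0 (A - y / l)) :=
    hω.mono (mem_Ici.2 (le_max_left _ _)) (mem_Ici.2 (le_max_left _ _)) (by gcongr)
  have m2 : ω (max 0 ((y - l * A) / (1 - l))) ≤ ω (max 0 ((y' - l * A) / (1 - l))) :=
    hω.mono (mem_Ici.2 (le_max_left _ _)) (mem_Ici.2 (le_max_left _ _)) (by gcongr)
  unfold branch
  nlinarith

/-- By subadditivity the increment is at most `l * ω m + (1 - l) * ω n`, where `m` and `n` are the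
changes of the two truncated arguments. Concavity bounds this by `ω (l * m + (1 - l) * n)`, and that
weighted sum is `y' - y`. -/
theorem branch_sub_le {l A y y' : ℝ} (hω : IsModulus ω) (hconc : ConcaveOn ℝ (Ici 0) ω)
    (hl : 0 < l) (hl1 : l < 1) (h : y ≤ y') :
    branch ω l A y' - branch ω l A y ≤ ω (y' - y) := by
  have hl' : 0 < 1 - l := sub_pos.2 hl1
  have key : ∀ m m' : ℝ, 0 ≤ m' → m' ≤ m → ω m - ω m' ≤ ω (m - m') := fun m m' h0 h => by
    have := hω.subadd m' (m - m') h0 (sub_nonneg.2 h)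
    rw [add_sub_cancel] at this
    linarith
  have hm : max 0 (A - y' / l) ≤ max 0 (A - y / l) := by gcongr
  have hn : max 0 ((y - l * A) / (1 - l)) ≤ max 0 ((y' - l * A) / (1 - l)) := by gcongr
  have k1 := key _ _ (le_max_left _ _) hm
  have k2 := key _ _ (le_max_left _ _) hn
  have hc := hconc.2 (mem_Ici.2 (sub_nonneg.2 hm)) (mem_Ici.2 (sub_nonneg.2 hn)) hl.le hl'.le
    (by ring)
  simp only [smul_eq_mul] at hc
  -- At most one of the two truncations is nonzero, and their weighted difference recovers the
  -- position `y`.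
  have hid : ∀ y, l * max 0 (A - y / l) - (1 - l) * max 0 ((y - l * A) / (1 - l)) =
      l * A - y := fun y => by
    rw [mul_max_of_nonneg _ _ hl.le, mul_max_of_nonneg _ _ hl'.le, mul_zero, mul_zero,
      mul_div_cancel₀ _ hl'.ne', mul_sub, mul_div_cancel₀ _ hl.ne']
    rcases le_total (l * A) y with hy | hy
    · rw [max_eq_left (by linarith), max_eq_right (by linarith)]; ring
    · rw [max_eq_right (by linarith), max_eq_left (by linarith)]; ring
  have he : l * (max 0 (A - y / l) - max 0 (A - y' / l)) +
      (1 - l) * (max 0 ((y' - l * A) / (1 - l)) - max 0 ((y - l * A) / (1 - l))) = y' - y := by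
    linarith [hid y, hid y']
  rw [he] at hc
  refine le_trans ?_ hc
  unfold branch
  have := mul_le_mul_of_nonneg_left k1 hl.le
  have := mul_le_mul_of_nonneg_left k2 hl'.le
  linarith

/-- The extremal function for the approximation of divided differences: it attains its maximum
at `p` and is constant to the left of `p - A₁` and to the right of `p + A₂`. -/
noncomputable def divDiffExtremal (ω : ℝ → ℝ) (l A₁ A₂ p s : ℝ) : ℝ :=
  ω (max A₁ A₂) - branch ω l A₁ (max 0 (min A₁ (p - s))) - branch ω l A₂ (max 0 (min A₂ (s - p)))

theorem divDiffExtremal_of_le {l A₁ A₂ p s : ℝ} (hω : IsModulus ω) (hl : 0 < l) (hl1 : l < 1)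
    (hA₁ : 0 ≤ A₁) (hA₂ : 0 ≤ A₂) (hs : s ≤ p) :
    divDiffExtremal ω l A₁ A₂ p s = ω (max A₁ A₂) - branch ω l A₁ (min A₁ (p - s)) := by
  rw [divDiffExtremal, max_eq_left (min_le_of_right_le (sub_nonpos.2 hs)),
    branch_zero hω hl hl1 hA₂, sub_zero, max_eq_right (le_min hA₁ (sub_nonneg.2 hs))]

theorem divDiffExtremal_of_ge {l A₁ A₂ p s : ℝ} (hω : IsModulus ω) (hl : 0 < l) (hl1 : l < 1)
    (hA₁ : 0 ≤ A₁) (hA₂ : 0 ≤ A₂) (hs : p ≤ s) :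
    divDiffExtremal ω l A₁ A₂ p s = ω (max A₁ A₂) - branch ω l A₂ (min A₂ (s - p)) := by
  rw [divDiffExtremal, max_eq_left (a := 0) (min_le_of_right_le (sub_nonpos.2 hs)),
    branch_zero hω hl hl1 hA₁, sub_zero, max_eq_right (le_min hA₂ (sub_nonneg.2 hs))]

theorem divDiffExtremal_nonneg {l A₁ A₂ p : ℝ} (hω : IsModulus ω) (hl : 0 < l) (hl1 : l < 1)
    (hA₁ : 0 ≤ A₁) (hA₂ : 0 ≤ A₂) (s : ℝ) : 0 ≤ divDiffExtremal ω l A₁ A₂ p s := by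
  rcases le_total s p with hs | hs
  · rw [divDiffExtremal_of_le hω hl hl1 hA₁ hA₂ hs, sub_nonneg]
    calc _ ≤ branch ω l A₁ A₁ := branch_mono hω hl hl1 (min_le_left _ _)
      _ = ω A₁ := branch_self hω hl hl1 hA₁
      _ ≤ _ := hω.mono hA₁ (hA₁.trans (le_max_left _ _)) (le_max_left _ _)
  · rw [divDiffExtremal_of_ge hω hl hl1 hA₁ hA₂ hs, sub_nonneg]
    calc _ ≤ branch ω l A₂ A₂ := branch_mono hω hl hl1 (min_le_left _ _)
      _ = ω A₂ := branch_self hω hl hl1 hA₂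
      _ ≤ _ := hω.mono hA₂ (hA₁.trans (le_max_left _ _)) (le_max_right _ _)

theorem max_min_sub_le {A x y : ℝ} (h : x ≤ y) :
    max 0 (min A y) - max 0 (min A x) ≤ y - x := by
  have h1 := abs_max_sub_max_le_max 0 (min A y) 0 (min A x)
  have h2 := abs_min_sub_min_le_max A y A x
  simp only [sub_self, abs_zero, abs_nonneg, sup_of_le_right] at h1 h2
  rw [abs_of_nonneg (sub_nonneg.2 h)] at h2
  exact (le_abs_self _).trans (h1.trans h2)

theorem abs_divDiffExtremal_sub_le {l A₁ A₂ p : ℝ} (hω : IsModulus ω)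
    (hconc : ConcaveOn ℝ (Ici 0) ω) (hl : 0 < l) (hl1 : l < 1) (s s' : ℝ) :
    |divDiffExtremal ω l A₁ A₂ p s - divDiffExtremal ω l A₁ A₂ p s'| ≤ ω |s - s'| := by
  wlog h : s ≤ s' generalizing s s'
  · rw [abs_sub_comm, abs_sub_comm s]
    exact this s' s (le_of_not_ge h)
  have key : ∀ A x y : ℝ, x ≤ y →
      0 ≤ branch ω l A (max 0 (min A y)) - branch ω l A (max 0 (min A x)) ∧
      branch ω l A (max 0 (min A y)) - branch ω l A (max 0 (min A x)) ≤ ω (y - x) := by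
    intro A x y hxy
    have hm : max 0 (min A x) ≤ max 0 (min A y) := by gcongr
    exact ⟨sub_nonneg.2 (branch_mono hω hl hl1 hm), (branch_sub_le hω hconc hl hl1 hm).trans
      (hω.mono (sub_nonneg.2 hm) (sub_nonneg.2 hxy) (max_min_sub_le hxy))⟩
  have k1 := key A₁ (p - s') (p - s) (by linarith)
  have k2 := key A₂ (s - p) (s' - p) (by linarith)
  rw [show p - s - (p - s') = s' - s by ring] at k1
  rw [show s' - p - (s - p) = s' - s by ring] at k2
  rw [abs_sub_comm s, abs_of_nonneg (sub_nonneg.2 h), abs_le]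
  unfold divDiffExtremal
  constructor <;> linarith

/-- The maximum `ω (max A₁ A₂)` is exactly used up by the longer branch. Beyond a strictly shorter
one a plateau, possibly positive, remains, hence the condition `A₂ ≤ A₁`. -/
theorem divDiffExtremal_eq_zero_of_le {l A₁ A₂ p s : ℝ} (hω : IsModulus ω) (hl : 0 < l)
    (hl1 : l < 1) (hA₁ : 0 ≤ A₁) (hA₂ : 0 ≤ A₂) (hA : A₂ ≤ A₁) (hs : s ≤ p - A₁) :
    divDiffExtremal ω l A₁ A₂ p s = 0 := by
  rw [divDiffExtremal_of_le hω hl hl1 hA₁ hA₂ (by linarith), min_eq_left (by linarith),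
    branch_self hω hl hl1 hA₁, max_eq_left hA, sub_self]

theorem divDiffExtremal_eq_zero_of_ge {l A₁ A₂ p s : ℝ} (hω : IsModulus ω) (hl : 0 < l)
    (hl1 : l < 1) (hA₁ : 0 ≤ A₁) (hA₂ : 0 ≤ A₂) (hA : A₁ ≤ A₂) (hs : p + A₂ ≤ s) :
    divDiffExtremal ω l A₁ A₂ p s = 0 := by
  rw [divDiffExtremal_of_ge hω hl hl1 hA₁ hA₂ (by linarith), min_eq_left (by linarith),
    branch_self hω hl hl1 hA₂, max_eq_right hA, sub_self]

theorem divDiffExtremal_left {l A₁ A₂ p z : ℝ} (hω : IsModulus ω) (hl : 0 < l) (hl1 : l < 1)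
    (hA₂ : 0 ≤ A₂) (hz : 0 ≤ z) (hzA : z ≤ A₁) :
    divDiffExtremal ω l A₁ A₂ p (p - l * A₁ + l * z) -
      divDiffExtremal ω l A₁ A₂ p (p - l * A₁ - (1 - l) * z) = ω z := by
  have hl' : 0 < 1 - l := sub_pos.2 hl1
  have hA₁ := hz.trans hzA
  have m1 := mul_le_mul_of_nonneg_left hzA hl.le
  have m2 := mul_le_mul_of_nonneg_left hzA hl'.le
  have m3 := mul_nonneg hl.le hz
  have m4 := mul_nonneg hl'.le hz
  rw [divDiffExtremal_of_le hω hl hl1 hA₁ hA₂ (by linarith),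
    divDiffExtremal_of_le hω hl hl1 hA₁ hA₂ (by linarith),
    min_eq_right (by linarith), min_eq_right (by linarith),
    show p - (p - l * A₁ + l * z) = l * A₁ - l * z by ring,
    show p - (p - l * A₁ - (1 - l) * z) = l * A₁ + (1 - l) * z by ring,
    branch_inner hω hl hl1 hz, branch_outer hω hl hl1 hz]
  ring

theorem divDiffExtremal_right {l A₁ A₂ p z : ℝ} (hω : IsModulus ω) (hl : 0 < l) (hl1 : l < 1)
    (hA₁ : 0 ≤ A₁) (hz : 0 ≤ z) (hzA : z ≤ A₂) :
    divDiffExtremal ω l A₁ A₂ p (p + l * A₂ - l * z) -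
      divDiffExtremal ω l A₁ A₂ p (p + l * A₂ + (1 - l) * z) = ω z := by
  have hl' : 0 < 1 - l := sub_pos.2 hl1
  have hA₂ := hz.trans hzA
  have m1 := mul_le_mul_of_nonneg_left hzA hl.le
  have m2 := mul_le_mul_of_nonneg_left hzA hl'.le
  have m3 := mul_nonneg hl.le hz
  have m4 := mul_nonneg hl'.le hz
  rw [divDiffExtremal_of_ge hω hl hl1 hA₁ hA₂ (by linarith),
    divDiffExtremal_of_ge hω hl hl1 hA₁ hA₂ (by linarith),
    min_eq_right (by linarith), min_eq_right (by linarith),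
    show p + l * A₂ - l * z - p = l * A₂ - l * z by ring,
    show p + l * A₂ + (1 - l) * z - p = l * A₂ + (1 - l) * z by ring,
    branch_inner hω hl hl1 hz, branch_outer hω hl hl1 hz]
  ring

/-- Equality in the transport estimate is needed at all pairs. With `z = c * x`, the relations `l *
c = (γ₁ + γ₂) / D` and `(1 - l) * c = 1` make the pairs of `average_sub_average` those of
`divDiffExtremal_left` and `divDiffExtremal_right`. Vanishing is claimed only beyond the longer
branch. -/
theorem exists_divDiffExtremal (hω : IsModulus ω) (hconc : ConcaveOn ℝ (Ici 0) ω)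
    {t γ₁ γ₂ h₁ h₂ : ℝ} (hγ : 0 < γ₁ + γ₂) (h1 : γ₁ ≤ h₁) (h2 : γ₂ ≤ h₂)
    (hD : 0 < h₁ - γ₁ + (h₂ - γ₂)) :
    ∃ ψ : ℝ → ℝ, (∀ s s', |ψ s - ψ s'| ≤ ω |s - s'|) ∧ (∀ s, 0 ≤ ψ s) ∧
      (h₂ - γ₂ ≤ h₁ - γ₁ → ∀ s ≤ t - h₁, ψ s = 0) ∧
      (h₁ - γ₁ ≤ h₂ - γ₂ → ∀ s, t + h₂ ≤ s → ψ s = 0) ∧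
      (γ₁ + γ₂)⁻¹ * (∫ s in (t - γ₁)..(t + γ₂), ψ s) -
        (h₁ + h₂)⁻¹ * (∫ s in (t - h₁)..(t + h₂), ψ s) = Kω ω γ₁ γ₂ h₁ h₂ := by
  set D := h₁ - γ₁ + (h₂ - γ₂) with hDdef
  have hH : 0 < h₁ + h₂ := by linarith
  set c := (h₁ + h₂) / D with hc
  have hc0 : 0 < c := by positivity
  set l := (γ₁ + γ₂) / (h₁ + h₂) with hl
  have hl0 : 0 < l := by positivity
  have hl1 : l < 1 := by rw [hl, div_lt_one hH]; linarith
  have hd1 : 0 ≤ h₁ - γ₁ := sub_nonneg.2 h1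
  have hd2 : 0 ≤ h₂ - γ₂ := sub_nonneg.2 h2
  have hlc : l * c = (γ₁ + γ₂) / D := by rw [hl, hc]; field_simp
  have hlc' : (1 - l) * c = 1 := by
    rw [hl, hc]; field_simp; rw [hDdef]; ring
  have hlcA : l * (c * (h₁ - γ₁)) + l * (c * (h₂ - γ₂)) = γ₁ + γ₂ := by
    rw [← mul_add, ← mul_add, ← hDdef, hc, hl]; field_simp
  have hA₁ : 0 ≤ c * (h₁ - γ₁) := by positivity
  have hA₂ : 0 ≤ c * (h₂ - γ₂) := by positivity
  -- The maximum sits at the cut point of the transport.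
  set p := t - γ₁ + l * (c * (h₁ - γ₁)) with hp
  have hp' : p = t + γ₂ - l * (c * (h₂ - γ₂)) := by rw [hp]; linarith
  have hA₁' : c * (h₁ - γ₁) = l * (c * (h₁ - γ₁)) + (h₁ - γ₁) := by
    have := congrArg (· * (h₁ - γ₁)) hlc'
    linarith
  have hA₂' : c * (h₂ - γ₂) = l * (c * (h₂ - γ₂)) + (h₂ - γ₂) := by
    have := congrArg (· * (h₂ - γ₂)) hlc'
    linarith
  have hmod := abs_divDiffExtremal_sub_le (A₁ := c * (h₁ - γ₁)) (A₂ := c * (h₂ - γ₂)) (p := p)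
    hω hconc hl0 hl1
  have hcont : Continuous (divDiffExtremal ω l (c * (h₁ - γ₁)) (c * (h₂ - γ₂)) p) :=
    hω.continuous_of_dist_le hmod
  refine ⟨divDiffExtremal ω l (c * (h₁ - γ₁)) (c * (h₂ - γ₂)) p, hmod,
    divDiffExtremal_nonneg hω hl0 hl1 hA₁ hA₂, fun h s hs => ?_, fun h s hs => ?_, ?_⟩
  · exact divDiffExtremal_eq_zero_of_le hω hl0 hl1 hA₁ hA₂
      (mul_le_mul_of_nonneg_left h hc0.le) (by linarith)
  · exact divDiffExtremal_eq_zero_of_ge hω hl0 hl1 hA₁ hA₂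
      (mul_le_mul_of_nonneg_left h hc0.le) (by linarith)
  · have key := average_sub_average hcont (q₁ := t - γ₁) (q₂ := t + γ₂) (d₁ := h₁ - γ₁)
      (d₂ := h₂ - γ₂) (by linarith) hD
    rw [← hDdef, show t + γ₂ - (t - γ₁) = γ₁ + γ₂ by ring,
      show γ₁ + γ₂ + D = h₁ + h₂ by rw [hDdef]; ring,
      show t - γ₁ - (h₁ - γ₁) = t - h₁ by ring, show t + γ₂ + (h₂ - γ₂) = t + h₂ by ring,
      smul_eq_mul, smul_eq_mul, smul_eq_mul, ← hlc] at key
    rw [key]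
    have i1 : ∫ x in (0 : ℝ)..(h₁ - γ₁),
        (divDiffExtremal ω l (c * (h₁ - γ₁)) (c * (h₂ - γ₂)) p (t - γ₁ + l * c * x) -
          divDiffExtremal ω l (c * (h₁ - γ₁)) (c * (h₂ - γ₂)) p (t - γ₁ - x)) =
        c⁻¹ * Iω ω (c * (h₁ - γ₁)) := by
      rw [← integral_modulus_comp_mul hc0 hd1]
      refine intervalIntegral.integral_congr fun x hx => ?_
      rw [uIcc_of_le hd1] at hx
      have hz : 0 ≤ c * x := mul_nonneg hc0.le hx.1
      rw [abs_of_nonneg hz, ← divDiffExtremal_left (A₂ := c * (h₂ - γ₂)) (p := p) hω hl0 hl1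
        hA₂ hz (mul_le_mul_of_nonneg_left hx.2 hc0.le),
        ← mul_assoc (1 - l), hlc', one_mul, hp, add_sub_cancel_right, mul_assoc]
    have i2 : ∫ x in (0 : ℝ)..(h₂ - γ₂),
        (divDiffExtremal ω l (c * (h₁ - γ₁)) (c * (h₂ - γ₂)) p (t + γ₂ - l * c * x) -
          divDiffExtremal ω l (c * (h₁ - γ₁)) (c * (h₂ - γ₂)) p (t + γ₂ + x)) =
        c⁻¹ * Iω ω (c * (h₂ - γ₂)) := by
      rw [← integral_modulus_comp_mul hc0 hd2]
      refine intervalIntegral.integral_congr fun x hx => ?_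
      rw [uIcc_of_le hd2] at hx
      have hz : 0 ≤ c * x := mul_nonneg hc0.le hx.1
      rw [abs_of_nonneg hz, ← divDiffExtremal_right (A₁ := c * (h₁ - γ₁)) (p := p) hω hl0 hl1
        hA₁ hz (mul_le_mul_of_nonneg_left hx.2 hc0.le),
        ← mul_assoc (1 - l), hlc', one_mul, hp', sub_add_cancel, mul_assoc]
    rw [i1, i2, Kω, ← hDdef, hc, inv_div, div_mul_eq_mul_div, div_mul_eq_mul_div]
    field_simp

end

end LSpaces
-- The upper and lower bounds combined
theorem mainTheorem11 {X : Type*} [MetricSpace X] [AddCommMonoid X] [DistribMulAction ℝ X]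
    [LSpace X] (hiso : Isotropic X)
    (hX : invertibleElements X ∩ convexElements X ≠ {0})
    (P : X → X) (hP : IsConvexifying P)
    (ω : ℝ → ℝ) (hω : IsModulus ω)
    (a b : ℝ) (hab : a < b) (t : ℝ) (ht : t ∈ Set.Icc a b)
    (γ h : ℝ) (hγ : 0 < γ) (hγh : γ < h)
    (γ₁ γ₂ h₁ h₂ : ℝ)
    (hγ₁ : γ₁ = min γ (t - a)) (hγ₂ : γ₂ = min γ (b - t))
    (hh₁ : h₁ = min h (t - a)) (hh₂ : h₂ = min h (b - t)) :
    -- the operators are well defined on the class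
    (∀ f ∈ W1Hω P ω a b, f ∈ CH X a b ∧
      ∃ z : X, HasHDeriv a b (Set.IccExtend hab.le f) t z) ∧
    -- the optimal operator is admissible
    Admissible (2 / (h₁ + h₂)) (fun f : CH X a b => divDiffOp hab.le h₁ h₂ t f.1) ∧
    -- divided differences, concave modulus
    (ConcaveOn ℝ (Set.Ici 0) ω →
      bestApprox P ω (divDiffOp hab.le γ₁ γ₂ t) (2 / (h₁ + h₂)) =
          deviation P ω (divDiffOp hab.le γ₁ γ₂ t)
            (fun f : CH X a b => divDiffOp hab.le h₁ h₂ t f.1) ∧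
        deviation P ω (divDiffOp hab.le γ₁ γ₂ t)
            (fun f : CH X a b => divDiffOp hab.le h₁ h₂ t f.1) =
          ENNReal.ofReal (Kω ω γ₁ γ₂ h₁ h₂)) ∧
    -- derivative, arbitrary modulus
    (bestApprox P ω (derivOp hab.le t) (2 / (h₁ + h₂)) =
        deviation P ω (derivOp hab.le t)
          (fun f : CH X a b => divDiffOp hab.le h₁ h₂ t f.1) ∧
      deviation P ω (derivOp hab.le t)
          (fun f : CH X a b => divDiffOp hab.le h₁ h₂ t f.1) =
        ENNReal.ofReal ((Iω ω h₁ + Iω ω h₂) / (h₁ + h₂))) := by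
  obtain ⟨E, _, _, _, ι, hι⟩ := exists_isConvexEmbedding hiso hP
  obtain ⟨J, hJ⟩ := exists_isConvexLine hiso hP hX
  have hta : 0 ≤ t - a := sub_nonneg.2 ht.1
  have htb : 0 ≤ b - t := sub_nonneg.2 ht.2
  have hh0 : 0 < h := hγ.trans hγh
  have pγ₁ : 0 ≤ γ₁ := hγ₁ ▸ le_min hγ.le hta
  have pγ₂ : 0 ≤ γ₂ := hγ₂ ▸ le_min hγ.le htb
  have l₁ : γ₁ ≤ h₁ := by rw [hγ₁, hh₁]; exact min_le_min_right _ hγh.le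
  have l₂ : γ₂ ≤ h₂ := by rw [hγ₂, hh₂]; exact min_le_min_right _ hγh.le
  have ph₁ : 0 ≤ h₁ := pγ₁.trans l₁
  have ph₂ : 0 ≤ h₂ := pγ₂.trans l₂
  have hγs : 0 < γ₁ + γ₂ := by
    rcases hta.eq_or_lt with h0 | h0
    · have : 0 < γ₂ := hγ₂ ▸ lt_min hγ (by linarith)
      linarith
    · have : 0 < γ₁ := hγ₁ ▸ lt_min hγ h0
      linarith
  have hhs : 0 < h₁ + h₂ := by linarith
  have hh₁h : h₁ ≤ h := hh₁ ▸ min_le_left _ _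
  have hh₂h : h₂ ≤ h := hh₂ ▸ min_le_left _ _
  have hh₁a : h₁ ≤ t - a := hh₁ ▸ min_le_right _ _
  have hh₂b : h₂ ≤ b - t := hh₂ ▸ min_le_right _ _
  have ht₁ : t - h₁ ∈ Set.Icc a b := ⟨by linarith, by linarith [ht.2]⟩
  have ht₂ : t + h₂ ∈ Set.Icc a b := ⟨by linarith [ht.1], by linarith⟩
  have hs₁ : t - γ₁ ∈ Set.Icc a b := ⟨by linarith, by linarith [ht.2]⟩
  have hs₂ : t + γ₂ ∈ Set.Icc a b := ⟨by linarith [ht.1], by linarith⟩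
  -- Points of `[a, b]` to the left of `t - h₁` exist only if the end point `a` did not shorten the
  -- step.
  have hleft : ∀ s ∈ Set.Icc a b, s < t - h₁ → h₁ = h := fun s hs hlt => by
    rcases min_choice h (t - a) with h' | h'
    · rw [hh₁, h']
    · rw [hh₁, h'] at hlt; linarith [hs.1]
  have hright : ∀ s ∈ Set.Icc a b, t + h₂ < s → h₂ = h := fun s hs hlt => by
    rcases min_choice h (b - t) with h' | h'
    · rw [hh₂, h']
    · rw [hh₂, h'] at hlt; linarith [hs.2]
  have hadm := admissible_divDiffOp (X := X) hiso hab.le hhs ht₁ ht₂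
  have squeeze : ∀ {A : (Set.Icc a b → X) → X} {K : ℝ≥0∞},
      deviation P ω A (fun f : CH X a b => divDiffOp hab.le h₁ h₂ t f.1) ≤ K →
      K ≤ bestApprox P ω A (2 / (h₁ + h₂)) →
      bestApprox P ω A (2 / (h₁ + h₂)) =
          deviation P ω A (fun f : CH X a b => divDiffOp hab.le h₁ h₂ t f.1) ∧
        deviation P ω A (fun f : CH X a b => divDiffOp hab.le h₁ h₂ t f.1) = K := by
    intro A K hU hE
    have hEU : bestApprox P ω A (2 / (h₁ + h₂)) ≤
        deviation P ω A (fun f : CH X a b => divDiffOp hab.le h₁ h₂ t f.1) := iInf₂_le _ hadm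
    exact ⟨le_antisymm hEU (hU.trans hE), le_antisymm hU (hE.trans hEU)⟩
  refine ⟨fun f hf => ?_, hadm, fun hconc => ?_, ?_⟩
  · obtain ⟨Ψ, hΨ⟩ := exists_isEmbeddedDeriv hι hP hω hab.le hf
    exact ⟨hΨ.mem_CH hiso hι hP hω, _, (hΨ.derivOp_spec hiso hι hP hω hab ht).1⟩
  · refine squeeze (deviation_divDiffOp_le hiso hι hP hω hab.le hγs pγ₁ pγ₂ l₁ l₂ hs₁ hs₂ ht₁ ht₂)
      ?_
    rcases (add_nonneg (sub_nonneg.2 l₁) (sub_nonneg.2 l₂)).eq_or_lt with hD | hD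
    · have : Kω ω γ₁ γ₂ h₁ h₂ = 0 := by simp [Kω, ← hD]
      rw [this, ENNReal.ofReal_zero]
      exact zero_le
    · obtain ⟨ψ, hψ, h0, hz₁, hz₂, hval⟩ :=
        exists_divDiffExtremal (t := t) hω hconc hγs l₁ l₂ hD
      -- If one of `h₁`, `h₂` equals `h`, its excess over the corresponding `γ₁` or `γ₂` is at least
      -- `h - γ`, and the other excess is at most that. So wherever vanishing is required, the
      -- branch on that side is the longer one.
      have hdle : ∀ x : ℝ, min h x - min γ x ≤ h - γ := fun x => by
        rcases le_total x γ with hx | hx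
        · rw [min_eq_right hx, min_eq_right (hx.trans hγh.le)]; linarith
        · rw [min_eq_left hx]; linarith [min_le_left h x]
      have hγle : ∀ x : ℝ, min γ x ≤ γ := fun x => min_le_left _ _
      rw [← hval]
      refine le_bestApprox hiso hι hP hJ hω hψ hhs ht₁ ht₂ (fun s _ => h0 s)
        (fun s hs hlt => ?_) fun f hf => ?_
      · rcases hlt with hlt | hlt
        · refine hz₁ ?_ s hlt.le
          rw [hleft s hs hlt, hh₂, hγ₂, hγ₁]
          linarith [hdle (b - t), hγle (t - a)]
        · refine hz₂ ?_ s hlt.le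
          rw [hright s hs hlt, hh₁, hγ₂, hγ₁]
          linarith [hdle (t - a), hγle (b - t)]
      · rw [(hf.divDiffOp_spec hiso hι hP hω hab.le pγ₁ pγ₂ hs₁ hs₂).2,
          intervalIntegral.integral_smul_const, smul_smul]
  · refine squeeze (deviation_derivOp_le hiso hι hP hω hab ht hhs ph₁ ph₂ ht₁ ht₂) ?_
    -- The radius `h` serves both sides: where an end point has cut the step below `h`, no point of
    -- `[a, b]` lies beyond, so no vanishing is needed there.
    rw [← derivExtremal_sub_average (t := t) hω hhs ph₁ ph₂ hh₁h hh₂h]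
    refine le_bestApprox hiso hι hP hJ hω (abs_derivExtremal_sub_le hω h t) hhs ht₁ ht₂
      (fun s _ => le_max_left _ _) (fun s hs hlt => derivExtremal_eq_zero hω hh0.le ?_)
      fun f hf => (hf.derivOp_spec hiso hι hP hω hab ht).2.2
    rcases hlt with hlt | hlt
    · rw [le_abs]; right
      linarith [hleft s hs hlt]
    · rw [le_abs]; left
      linarith [hright s hs hlt]
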